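/- Work in the random oracle model. Public parameters are the key length $\kappa\ge 1$, the number of states $|Q|\ge 1$, the alphabet $\Sigma$, and the input length $n\ge 1$. The server holds a finite-state machine $\mathcal M=(Q,q_0,\Sigma,\delta,Q_{\mathsf{accept}})$, the client a string $x=x_1\ldots x_n\in\Sigma^n$, and the helper has no input. Write $\mathcal M(x)\in\{0,1\}$ for the acceptance bit. The hash functions $H:\{0,1\}^{\kappa+\lceil\log|\Sigma|\rceil}\to\{0,1\}^{\lceil\log|Q|\rceil+\kappa}$ and $H':\{0,1\}^{\kappa+\lceil\log n\rceil}\to(\{0,1\}^{\lceil\log|Q|\rceil+\kappa})^{|Q|}$ are independent random oracles. The protocol $\pi_{\mathsf{Helper}}$ is the following. \begin{enumerate} \item The server picks independent uniform keys $k^i_q\in\{0,1\}^\kappa$, rotations $r_i\in\mathbb Z_{|Q|}$ ($1\le i\le n$, $q\in\mathbb{Z}_{|Q|}\cong Q$), a bit $r$ (its output share), and a key $k_{SH}\in\{0,1\}^\kappa$. With $q'=\delta(q-r_i,\sigma)$ it sets $G(q,\sigma,i)=H(k^i_q\|\sigma)\oplus\big(q'+r_{i+1}\,\|\,k^{i+1}_{q'+r_{i+1}}\big)$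 for $i<n$, and $G(q,\sigma,n)=H(k^n_q\|\sigma)\oplus (r\oplus[q'\in Q_{\mathsf{accept}}])$ (the bit being padded with zeros). It sends all $G(q,\sigma,i)$ and $k_{SH}$ to the helper. \item The client picks uniform bits $x^S_{i,j}$ and puts $x^H_{i,j}=x^S_{i,j}\oplus x_{i,j}$, where $x_{i,j}=1$ if $x_i=j$ and $x_{i,j}=0$ otherwise. It sends $(x^S_{i,j})$ to the server and $(x^H_{i,j})$ to the helper. \item For each $i$, the server sends to the client $\bigoplus_{j:x^S_{i,j}=1}G(\cdot,j,i)\oplus H'(k_{SH}\|i)$, and the helper sends $\bigoplus_{j:x^H_{i,j}=1}G(\cdot,j,i)\oplus H'(k_{SH}\|i)$. The server also sends the rotated initial state $q_1=q_0+r_1$ and its key $k^1_{q_1}$. \item The client XORs the two answers for each $i$, and then, starting from $(q_1,k^1_{q_1})$, decrypts one entry of each resulting column in turn; the last one gives its output share. The output of the server is $r$. \end{enumerate} The following hold. \begin{enumerate} \item[(a)] (Correctness) For all inputs, oracles and coins, the XOR of the two answers for position $i$ is the column $G(\cdot,x_i,i)$, and the client's output is $r\oplus\mathcal M(x)$. \item[(b)]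 (Simulation security against a semi-honest client) There is a probabilistic simulator with oracle access to $H,H'$ (a straight-line program that may also sample uniformly from $\{0,\ldots,m\}$), whose cost is polynomial in $\kappa+|Q|+|\Sigma|+n$, such that the following holds. Let $\kappa\ge\lambda$, $|Q|$, $|\Sigma|$, $n$ be polynomially bounded functions of the security parameter $\lambda$, and let $(\mathcal M_\lambda)$, $(x_\lambda)$ be families of inputs. Then no family of distinguishers that make polynomially many queries to $H,H'$ (and are otherwise computationally unbounded and probabilistic) tells apart, with more than negligible advantage, the pair consisting of the client's view in $\pi_{\mathsf{Helper}}$ (its input, its coins, the messages it receives) and the server's output $r$, and the pair consisting of the output of the simulator on $(x,z)$ and $r$, where $r$ is a uniform bit and $z=r\oplus\mathcal M(x)$. \item[(c)] (Privacy against a malicious server) For parameters as in (b), let a malicious server, probabilistic and with polynomially many oracle queries, choose $x^{(0)},x^{(1)}\in\Sigma^n$; for a uniform bit $b$, the honest client and the honest helper run $\pi_{\mathsf{Helper}}$ with it, the client on input $x^{(b)}$; the server sends arbitrary messages and finally outputs $b'$. Then $|\Pr[b'=b]-\tfrac12|$ is negligible. \item[(d)] (Privacy against a malicious helper) For parameters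 as in (b), let a malicious helper, probabilistic and with polynomially many oracle queries, choose two pairs $(\mathcal M^{(0)},x^{(0)})$, $(\mathcal M^{(1)},x^{(1)})$ of inputs with the given public parameters; for a uniform bit $b$, the honest server and the honest client run $\pi_{\mathsf{Helper}}$ with it on inputs $\mathcal M^{(b)}$ and $x^{(b)}$; the helper sends arbitrary messages and finally outputs $b'$. Then $|\Pr[b'=b]-\tfrac12|$ is negligible. \end{enumerate} In each of (b), (c), (d) exactly one party is corrupted (no collusion). -/

import Mathlib

open Filter

namespace HelperProtocol

/-! ### Public parameters, bit strings, random oracles -/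

/-- Public parameters of one protocol instance: key length `κ`, number of states `nQ`,
size `nS` of the alphabet, and length `n` of the client's input. -/
structure Params where
  κ : ℕ
  nQ : ℕ
  nS : ℕ
  n : ℕ
  pos_κ : NeZero κ
  pos_nQ : NeZero nQ
  pos_n : NeZero n

attribute [instance] Params.pos_κ Params.pos_nQ Params.pos_n

/-- Bit strings of length `w`; XOR is the addition `+`. -/
abbrev Bits (w : ℕ) : Type := Fin w → ZMod 2

/-- Binary representation of `v` on `w` bits (least significant bit first). -/
def toBits (w v : ℕ) : Bits w := fun j => if v.testBit j then 1 else 0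

/-- The number with a given binary representation. -/
def ofBits {w : ℕ} (b : Bits w) : ℕ := ∑ j : Fin w, (b j).val * 2 ^ (j : ℕ)

namespace Params

variable (P : Params)

/-- Bit length of a state. -/
def lQ : ℕ := Nat.clog 2 P.nQ

/-- Bit length of a symbol. -/
def lS : ℕ := Nat.clog 2 P.nS

/-- Bit length of a position of the input. -/
def ln : ℕ := Nat.clog 2 P.n

/-- Overall size of the parameters. -/
def size : ℕ := P.κ + P.nQ + P.nS + P.n

end Params

/-- Keys: bit strings of length `κ`. -/
abbrev Key (P : Params) : Type := Bits P.κ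

/-- Entries of the garbled matrices: bit strings of length `⌈log nQ⌉ + κ`, written as the
concatenation (pair) of a state field and a key field. -/
abbrev Entry (P : Params) : Type := Bits P.lQ × Bits P.κ

/-- Columns of the garbled matrices, indexed by the (rotated) states. -/
abbrev Column (P : Params) : Type := Fin P.nQ → Entry P

/-- The two hash functions, modelled as random oracles: `H`, taking `k ‖ σ` to an entry,
and `mask` (written `H'` in the literature), taking `k ‖ i` to a column. -/
abbrev Oracles (P : Params) : Type :=
  (Key P × Bits P.lS → Entry P) × (Key P × Bits P.ln → Column P)

def Oracles.H {P : Params} (O : Oracles P) (k : Key P) (s : Bits P.lS) : Entry P := O.1 (k, s)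

def Oracles.mask {P : Params} (O : Oracles P) (k : Key P) (i : Bits P.ln) : Column P := O.2 (k, i)

/-! ### Finite-state machines -/

/-- The server's input: a finite-state machine with `nQ` states over `nS` symbols. -/
abbrev FSM (P : Params) : Type := DFA (Fin P.nS) (Fin P.nQ)

/-- The client's input: a string of length `n`. -/
abbrev Input (P : Params) : Type := Fin P.n → Fin P.nS

open Classical in
/-- The acceptance bit of a state. -/
noncomputable def acceptBit {P : Params} (M : FSM P) (q : Fin P.nQ) : ZMod 2 :=
  if q ∈ M.accept then 1 else 0

/-- Output bit of the machine `M` on the string `x`. -/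
noncomputable def result {P : Params} (M : FSM P) (x : Input P) : ZMod 2 :=
  acceptBit M (M.eval (List.ofFn x))

/-! ### The protocol -/

/-- The server's randomness: state keys `k i q`, rotations `rot i`, output mask `r`
(the server's share of the output), and the key `kSH` shared with the helper. -/
structure ServerCoins (P : Params) where
  k : Fin P.n → Fin P.nQ → Key P
  rot : Fin P.n → Fin P.nQ
  r : ZMod 2
  kSH : Key P

/-- All the server's random values are independent and uniform. -/
noncomputable def sampleServerCoins (P : Params) : PMF (ServerCoins P) := do
  let k ← PMF.uniformOfFintype (Fin P.n → Fin P.nQ → Key P)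
  let rot ← PMF.uniformOfFintype (Fin P.n → Fin P.nQ)
  let r ← PMF.uniformOfFintype (ZMod 2)
  let kSH ← PMF.uniformOfFintype (Key P)
  pure ⟨k, rot, r, kSH⟩

/-- An output share, padded with zeros to the length of an entry. -/
def padShare {P : Params} (z : ZMod 2) : Entry P := (0, fun j => if j = 0 then z else 0)

/-- The plaintext of row `q` (rotated state), column `s` in the `i`-th matrix: the rotated next
state with its key, and in the last matrix the masked acceptance bit of the next state. -/
noncomputable def payload {P : Params} (M : FSM P) (c : ServerCoins P)
    (i : Fin P.n) (s : Fin P.nS) (q : Fin P.nQ) : Entry P :=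
  let q' := M.step (q - c.rot i) s
  if h : (i : ℕ) + 1 < P.n then
    (toBits P.lQ (q' + c.rot ⟨i + 1, h⟩ : Fin P.nQ), c.k ⟨i + 1, h⟩ (q' + c.rot ⟨i + 1, h⟩))
  else padShare (c.r + acceptBit M q')

/-- The garbled matrices; `G i s` is the column of the symbol `s` in the `i`-th matrix. -/
abbrev Garbled (P : Params) : Type := Fin P.n → Fin P.nS → Column P

noncomputable def garble {P : Params} (O : Oracles P) (M : FSM P) (c : ServerCoins P) :
    Garbled P :=
  fun i s q => O.H (c.k i q) (toBits P.lS s) + payload M c i s q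

/-- One share of the one-hot encoded input. -/
abbrev Shares (P : Params) : Type := Fin P.n → Fin P.nS → ZMod 2

/-- One-hot encoding of the input. -/
def oneHot {P : Params} (x : Input P) : Shares P := fun i j => if x i = j then 1 else 0

/-- The share for the helper, when the (uniformly random) share for the server is `a`. -/
def helperShares {P : Params} (x : Input P) (a : Shares P) : Shares P := oneHot x + a

/-- What the server sends to the helper: the garbled matrices and the key `kSH`. -/
abbrev SetupMsg (P : Params) : Type := Garbled P × Key P

noncomputable def setupMsg {P : Params} (O : Oracles P) (M : FSM P) (c : ServerCoins P) :
    SetupMsg P := (garble O M c, c.kSH)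

/-- The masked partial answers of the server or the helper, one column for each position. -/
abbrev Answer (P : Params) : Type := Fin P.n → Column P

def partialAnswer {P : Params} (O : Oracles P) (m : SetupMsg P) (s : Shares P) : Answer P :=
  fun i => (∑ j ∈ Finset.univ.filter (fun j => s i j = 1), m.1 i j)
    + O.mask m.2 (toBits P.ln i)

/-- The (rotated) initial state, together with its key. -/
abbrev Start (P : Params) : Type := Fin P.nQ × Key P

def startMsg {P : Params} (M : FSM P) (c : ServerCoins P) : Start P :=
  (M.start + c.rot 0, c.k 0 (M.start + c.rot 0))

/-- The client's view: its input, its randomness (the shares it sent to the server), the messages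
of the server (`ansS`, `start`) and of the helper (`ansH`). -/
structure ClientView (P : Params) where
  x : Input P
  coins : Shares P
  ansS : Answer P
  start : Start P
  ansH : Answer P

/-- The client's view in an execution in which all parties follow the protocol. -/
noncomputable def clientView {P : Params} (O : Oracles P) (M : FSM P) (x : Input P)
    (c : ServerCoins P) (a : Shares P) : ClientView P where
  x := x
  coins := a
  ansS := partialAnswer O (setupMsg O M c) a
  start := startMsg M c
  ansH := partialAnswer O (setupMsg O M c) (helperShares x a)

/-- The columns that the client recovers by XORing the two partial answers. -/
def ClientView.columns {P : Params} (v : ClientView P) : Fin P.n → Column P :=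
  fun i => v.ansS i + v.ansH i

/-- One step of the client's evaluation: decrypt the row of the current state. -/
def evalStep {P : Params} (O : Oracles P) (v : ClientView P) (cur : Start P) (i : Fin P.n) :
    Start P :=
  let e := v.columns i cur.1 + O.H cur.2 (toBits P.lS (v.x i))
  (Fin.ofNat P.nQ (ofBits e.1), e.2)

/-- The client's output share: evaluate all the columns, and read the share off the entry
that was decrypted last. -/
def clientOutput {P : Params} (O : Oracles P) (v : ClientView P) : ZMod 2 :=
  ((List.finRange P.n).foldl (evalStep O v) v.start).2 0

/-! ### Adversaries -/

/-- Probabilistic computations with access to the two random oracles, and with no other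
restriction on their computing power. -/
inductive OracleComp (P : Params) (α : Type) : Type
  | done (a : α) : OracleComp P α
  | random (μ : PMF ℕ) (next : ℕ → OracleComp P α) : OracleComp P α
  | queryH (k : Key P) (s : Bits P.lS) (next : Entry P → OracleComp P α) : OracleComp P α
  | queryMask (k : Key P) (i : Bits P.ln) (next : Column P → OracleComp P α) : OracleComp P α

namespace OracleComp

variable {P : Params} {α : Type}

/-- The output distribution of a computation when the oracles are `O`. -/
noncomputable def run (O : Oracles P) : OracleComp P α → PMF α
  | done a => PMF.pure a
  | random μ next => μ.bind fun v => (next v).run O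
  | queryH k s next => (next (O.H k s)).run O
  | queryMask k i next => (next (O.mask k i)).run O

/-- The computation makes at most `T` oracle queries. -/
def QueryBound : OracleComp P α → ℕ → Prop
  | done _, _ => True
  | random _ next, T => ∀ v, (next v).QueryBound T
  | queryH _ _ next, T => 0 < T ∧ ∀ e, (next e).QueryBound (T - 1)
  | queryMask _ _ next, T => 0 < T ∧ ∀ e, (next e).QueryBound (T - 1)

end OracleComp

/-- A function of the security parameter that is bounded by a polynomial. -/
def PolyBounded (f : ℕ → ℕ) : Prop := ∃ c : ℕ, ∀ l, f l ≤ (l + 2) ^ c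

/-- A negligible function of the security parameter. -/
def Negligible (f : ℕ → ℝ) : Prop :=
  Asymptotics.SuperpolynomialDecay atTop (fun l : ℕ => (l : ℝ)) f

/-- Parameters as functions of the security parameter `l`: keys of length at least `l`, and all
sizes polynomial in `l`. -/
def Admissible (P : ℕ → Params) : Prop :=
  (∀ l, l ≤ (P l).κ) ∧ PolyBounded fun l => (P l).size

/-! ### Simulators: probabilistic straight-line programs with oracle gates, with their cost -/

/-- Memory of a program: one bit at each address. -/
abbrev Mem : Type := ℕ → ZMod 2

/-- Read the `w` bits from address `a` on. -/
def Mem.read (m : Mem) (a w : ℕ) : Bits w := fun j => m (a + j)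

/-- Write a string of `w` bits from address `d` on. -/
def Mem.write (m : Mem) (d : ℕ) {w : ℕ} (b : Bits w) : Mem :=
  fun a => if h : d ≤ a ∧ a - d < w then b ⟨a - d, h.2⟩ else m a

/-- Write an entry from address `d` on, the state field first. -/
def Mem.writeEntry {P : Params} (m : Mem) (d : ℕ) (e : Entry P) : Mem :=
  (m.write d e.1).write (d + P.lQ) e.2

/-- Write a column from address `d` on, row after row. -/
def Mem.writeColumn {P : Params} (m : Mem) (d : ℕ) (C : Column P) : Mem :=
  (List.finRange P.nQ).foldl (fun m' (q : Fin P.nQ) => m'.writeEntry (d + (q : ℕ) * (P.lQ + P.κ)) (C q)) m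

/-- Instructions; `d` is the address that is written, `a` and `b` are addresses that are read.
* `one`: write the bit 1.
* `xor`, `and`: write the XOR, or the AND, of two bits.
* `uniform`: write in binary a fresh uniformly random number from `{0, …, m}` (for `m + 1` that is
  no power of two, this is what rejection sampling does in expected time linear in the number
  of bits).
* `hash`: query `H` on the key at `a` and the symbol at `b`.
* `mask`: query `mask` on the key at `a` and the position at `b`. -/
inductive Instr : Type
  | one (d : ℕ)
  | xor (d a b : ℕ)
  | and (d a b : ℕ)
  | uniform (d m : ℕ)
  | hash (d a b : ℕ)
  | mask (d a b : ℕ)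

/-- The cost of an instruction: one, plus the number of bits that a sampling or an oracle
instruction reads and writes. -/
def Instr.cost (P : Params) : Instr → ℕ
  | one _ => 1
  | xor _ _ _ => 1
  | and _ _ _ => 1
  | uniform _ m => Nat.clog 2 (m + 1) + 1
  | hash _ _ _ => (P.κ + P.lS) + (P.lQ + P.κ) + 1
  | mask _ _ _ => (P.κ + P.ln) + P.nQ * (P.lQ + P.κ) + 1

noncomputable def Instr.exec {P : Params} (O : Oracles P) (m : Mem) : Instr → PMF Mem
  | one d => PMF.pure (Function.update m d 1)
  | xor d a b => PMF.pure (Function.update m d (m a + m b))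
  | and d a b => PMF.pure (Function.update m d (m a * m b))
  | uniform d u => (PMF.uniformOfFintype (Fin (u + 1))).map
      fun v => m.write d (toBits (Nat.clog 2 (u + 1)) v)
  | hash d a b => PMF.pure (m.writeEntry d (O.H (m.read a P.κ) (m.read b P.lS)))
  | mask d a b => PMF.pure (m.writeColumn d (O.mask (m.read a P.κ) (m.read b P.ln)))

noncomputable def execProg {P : Params} (O : Oracles P) : List Instr → Mem → PMF Mem
  | [], m => PMF.pure m
  | I :: prog, m => (I.exec O m).bind fun m' => execProg O prog m'

/-- The initial memory: the client's output share `z` at address `0`, and then the symbols of the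
client's input in binary, `lS` bits each. -/
def loadInput {P : Params} (x : Input P) (z : ZMod 2) : Mem
  | 0 => z
  | a + 1 => if h : a / P.lS < P.n then
      (if (x ⟨a / P.lS, h⟩ : ℕ).testBit (a % P.lS) then 1 else 0) else 0

/-- Simulator for the client: a straight-line program, and the addresses at which the bits of the
simulated view (other than the input `x`) are found when the program has ended. -/
structure Simulator (P : Params) where
  prog : List Instr
  coins : Fin P.n → Fin P.nS → ℕ
  ansS : Fin P.n → Fin P.nQ → ℕ
  startState : ℕ
  startKey : ℕ
  ansH : Fin P.n → Fin P.nQ → ℕ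

namespace Simulator

variable {P : Params}

def cost (S : Simulator P) : ℕ := (S.prog.map (Instr.cost P)).sum

def view (S : Simulator P) (x : Input P) (m : Mem) : ClientView P where
  x := x
  coins := fun i j => m (S.coins i j)
  ansS := fun i q => (m.read (S.ansS i q) P.lQ, m.read (S.ansS i q + P.lQ) P.κ)
  start := (Fin.ofNat P.nQ (ofBits (m.read S.startState P.lQ)), m.read S.startKey P.κ)
  ansH := fun i q => (m.read (S.ansH i q) P.lQ, m.read (S.ansH i q + P.lQ) P.κ)

/-- The simulated view, computed from the client's input `x` and output share `z` only. -/
noncomputable def run (O : Oracles P) (S : Simulator P) (x : Input P) (z : ZMod 2) :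
    PMF (ClientView P) :=
  (execProg O S.prog (loadInput x z)).map (S.view x)

end Simulator

/-! ### Security against a semi-honest client -/

/-- A distinguisher, given a view of the client and the output of the honest server. -/
abbrev Distinguisher (P : Params) : Type := ClientView P → ZMod 2 → OracleComp P Bool

/-- Real world: the distinguisher gets the client's view in the protocol and the server's output. -/
noncomputable def realClient {P : Params} (M : FSM P) (x : Input P) (D : Distinguisher P) :
    PMF Bool := do
  let O ← PMF.uniformOfFintype (Oracles P)
  let c ← sampleServerCoins P
  let a ← PMF.uniformOfFintype (Shares P)
  (D (clientView O M x c a) c.r).run O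

/-- Ideal world: the functionality shares the result of `M` on `x` between the server (share `r`)
and the client (share `z`), and the simulator gets `x` and `z`. -/
noncomputable def idealClient {P : Params} (S : Simulator P) (M : FSM P) (x : Input P)
    (D : Distinguisher P) : PMF Bool := do
  let O ← PMF.uniformOfFintype (Oracles P)
  let r ← PMF.uniformOfFintype (ZMod 2)
  let z := r + result M x
  let v ← S.run O x z
  (D v r).run O

/-! ### Privacy against a malicious server -/

/-- A malicious server chooses two inputs for the client; then, on receiving its shares from the
client, it sends arbitrary messages to the helper and to the client, and makes its guess. -/
structure MaliciousServer (P : Params) where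
  State : Type
  choose : OracleComp P (Input P × Input P × State)
  respond : State → Shares P → OracleComp P ((SetupMsg P × Answer P × Start P) × Bool)

def MaliciousServer.QueryBound {P : Params} (A : MaliciousServer P) (T : ℕ) : Prop :=
  A.choose.QueryBound T ∧ ∀ st a, (A.respond st a).QueryBound T

/-- The protocol with a malicious server, and an honest client and helper; the result is the
client's output together with the guess. Neither the helper nor the client sends anything to the
server after the shares. -/
noncomputable def MaliciousServer.exec {P : Params} (A : MaliciousServer P) (O : Oracles P)
    (st : A.State) (x : Input P) : PMF (ZMod 2 × Bool) := do
  let a ← PMF.uniformOfFintype (Shares P)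
  let out ← (A.respond st a).run O
  let ansH := partialAnswer O out.1.1 (helperShares x a)
  pure (clientOutput O ⟨x, a, out.1.2.1, out.1.2.2, ansH⟩, out.2)

/-- The privacy game for a malicious server; the outcome says whether it guessed right. -/
noncomputable def MaliciousServer.game {P : Params} (A : MaliciousServer P) : PMF Bool := do
  let O ← PMF.uniformOfFintype (Oracles P)
  let ch ← A.choose.run O
  let b ← PMF.uniformOfFintype Bool
  let out ← A.exec O ch.2.2 (if b then ch.2.1 else ch.1)
  pure (out.2 == b)

/-! ### Privacy against a malicious helper -/

/-- A malicious helper chooses two pairs of inputs for the server and the client; then, on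
receiving the messages of the server and the client, it sends an arbitrary message to the client,
and makes its guess. -/
structure MaliciousHelper (P : Params) where
  State : Type
  choose : OracleComp P ((FSM P × Input P) × (FSM P × Input P) × State)
  respond : State → SetupMsg P → Shares P → OracleComp P (Answer P × Bool)

def MaliciousHelper.QueryBound {P : Params} (A : MaliciousHelper P) (T : ℕ) : Prop :=
  A.choose.QueryBound T ∧ ∀ st m a, (A.respond st m a).QueryBound T

/-- The protocol with a malicious helper, and an honest server and client; the result is the output
of the server and of the client together with the guess. -/
noncomputable def MaliciousHelper.exec {P : Params} (A : MaliciousHelper P) (O : Oracles P)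
    (st : A.State) (M : FSM P) (x : Input P) : PMF ((ZMod 2 × ZMod 2) × Bool) := do
  let c ← sampleServerCoins P
  let a ← PMF.uniformOfFintype (Shares P)
  let out ← (A.respond st (setupMsg O M c) (helperShares x a)).run O
  let ansS := partialAnswer O (setupMsg O M c) a
  pure ((c.r, clientOutput O ⟨x, a, ansS, startMsg M c, out.1⟩), out.2)

/-- The privacy game for a malicious helper; the outcome says whether it guessed right. -/
noncomputable def MaliciousHelper.game {P : Params} (A : MaliciousHelper P) : PMF Bool := do
  let O ← PMF.uniformOfFintype (Oracles P)
  let ch ← A.choose.run O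
  let b ← PMF.uniformOfFintype Bool
  let y := if b then ch.2.1 else ch.1
  let out ← A.exec O ch.2.2 y.1 y.2
  pure (out.2 == b)

/-- The probability of the outcome `true`. -/
noncomputable def prob (p : PMF Bool) : ℝ := (p true).toReal

end HelperProtocol

open HelperProtocol

/-!
The two shares of the client select complementary sets of columns, except for the column of its
symbol; hence the two answers add up to that column. Since a single share is uniformly
distributed, the server learns nothing at all about `x`.

Against the helper and the client, the point is that an oracle at a key that the adversary does not
know is a one-time pad. For distinct keys, the oracles may be resampled at all the queries that
encrypt what must stay hidden, without changing their distribution, and an adversary that is run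
with the original oracles instead notices this only if it queries one of the hidden keys. Then its
messages are uniformly random and independent of these keys, so each of its queries hits a given
one with probability `2 ^ -κ`. With `N = n * |Q| + 1` keys and `T` queries this costs at most
`N * T / 2 ^ κ`, and the event that two keys coincide costs at most `N ^ 2 / 2 ^ κ`.

For the helper the hidden values are the whole garbled matrices. For the client they are the rows
off its path and the mask of the answer of the server; the rotations make the path uniformly
distributed, so it can be sampled without knowing the machine.
-/

namespace HelperProtocol

open scoped ENNReal

/-! ### Expectations over discrete distributions -/

section Expect

variable {α β γ : Type*}

/-- The expectation of a nonnegative function of a random value with distribution `p`. -/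
noncomputable def expect (p : PMF α) (f : α → ℝ≥0∞) : ℝ≥0∞ := ∑' a, p a * f a

/-- The average of a function over a nonempty finite type. -/
noncomputable abbrev avg [Fintype α] [Nonempty α] (f : α → ℝ≥0∞) : ℝ≥0∞ :=
  expect (PMF.uniformOfFintype α) f

lemma bind_apply_eq_expect (p : PMF α) (q : α → PMF β) (b : β) :
    (p.bind q) b = expect p fun a => q a b := rfl

lemma expect_pure (a : α) (f : α → ℝ≥0∞) : expect (PMF.pure a) f = f a := by
  rw [expect, tsum_eq_single a fun b hb => by simp [PMF.pure_apply, hb]]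
  simp

lemma expect_mono (p : PMF α) {f g : α → ℝ≥0∞} (h : ∀ a, f a ≤ g a) :
    expect p f ≤ expect p g :=
  ENNReal.tsum_le_tsum fun a => mul_le_mul_right (h a) _

lemma expect_add (p : PMF α) (f g : α → ℝ≥0∞) :
    (expect p fun a => f a + g a) = expect p f + expect p g := by
  simp only [expect, mul_add, ENNReal.tsum_add]

lemma expect_const (p : PMF α) (c : ℝ≥0∞) : (expect p fun _ => c) = c := by
  simp [expect, ENNReal.tsum_mul_right, p.tsum_coe]

lemma expect_le_of_le (p : PMF α) {f : α → ℝ≥0∞} {c : ℝ≥0∞} (h : ∀ a, f a ≤ c) :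
    expect p f ≤ c :=
  (expect_mono p h).trans (expect_const p c).le

lemma expect_comm (p : PMF α) (q : PMF β) (f : α → β → ℝ≥0∞) :
    (expect p fun a => expect q fun b => f a b) = expect q fun b => expect p fun a => f a b := by
  simp only [expect, ← ENNReal.tsum_mul_left, mul_left_comm (p _)]
  exact ENNReal.tsum_comm

lemma expect_bind (p : PMF α) (q : α → PMF β) (f : β → ℝ≥0∞) :
    expect (p.bind q) f = expect p fun a => expect (q a) f := by
  simp only [expect, PMF.bind_apply, ← ENNReal.tsum_mul_left, ← ENNReal.tsum_mul_right, mul_assoc]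
  exact ENNReal.tsum_comm

lemma expect_map (p : PMF α) (g : α → β) (f : β → ℝ≥0∞) :
    expect (p.map g) f = expect p fun a => f (g a) := by
  simp [PMF.map, expect_bind, expect_pure]

lemma expect_finset_sum (p : PMF α) (s : Finset β) (f : β → α → ℝ≥0∞) :
    (expect p fun a => ∑ b ∈ s, f b a) = ∑ b ∈ s, expect p (f b) := by
  simp only [expect, Finset.mul_sum]
  exact Summable.tsum_finsetSum fun _ _ => ENNReal.summable

variable [Fintype α] [Nonempty α] [Fintype β] [Nonempty β]

lemma avg_eq (f : α → ℝ≥0∞) : avg f = (Fintype.card α : ℝ≥0∞)⁻¹ * ∑ a, f a := by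
  simp [expect, tsum_fintype, Finset.mul_sum]

lemma avg_bijective {e : α → β} (he : e.Bijective) (f : β → ℝ≥0∞) :
    (avg fun a => f (e a)) = avg f := by
  rw [avg_eq, avg_eq, Fintype.card_of_bijective he, he.sum_comp]

lemma avg_prod (f : α × β → ℝ≥0∞) : avg f = avg fun a => avg fun b => f (a, b) := by
  simp only [avg_eq, Fintype.sum_prod_type, Fintype.card_prod, Nat.cast_mul, ← Finset.mul_sum]
  rw [ENNReal.mul_inv (by simp) (by simp), mul_assoc]

lemma avg_add_left [AddGroup α] (c : α) (f : α → ℝ≥0∞) : (avg fun a => f (c + a)) = avg f :=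
  avg_bijective (AddGroup.addLeft_bijective c) f

end Expect

section UniformFunctions

variable {ι X Y : Type*} [Fintype ι] [Fintype X] [Fintype Y] [Nonempty Y] [DecidableEq X]

/-- The values of a uniformly random function at distinct points may be resampled: exchanging the
old values with the fresh ones is an involution. -/
lemma avg_extend [DecidableEq ι] {f : ι → X} (hf : f.Injective) (F : (X → Y) → ℝ≥0∞) :
    (avg fun g => avg fun w => F (Function.extend f w g)) = avg F := by
  let swap (gw : (X → Y) × (ι → Y)) : (X → Y) × (ι → Y) :=
    (Function.extend f gw.2 gw.1, gw.1 ∘ f)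
  have hswap : swap.Involutive := fun ⟨g, w⟩ => by
    refine Prod.ext (funext fun x => ?_) (Function.extend_comp hf w g)
    by_cases hx : ∃ i, f i = x
    · obtain ⟨i, rfl⟩ := hx
      simp [swap, hf.extend_apply]
    · simp [swap, Function.extend_apply' _ _ _ hx]
  calc (avg fun g => avg fun w => F (Function.extend f w g))
      = avg fun gw => F (swap gw).1 := (avg_prod fun gw => F (swap gw).1).symm
    _ = avg fun gw : (X → Y) × (ι → Y) => F gw.1 :=
      avg_bijective hswap.bijective fun gw => F gw.1
    _ = avg F := by simp only [avg_prod, expect_const]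

lemma avg_comp_injective [DecidableEq ι] {f : ι → X} (hf : f.Injective) (F : (ι → Y) → ℝ≥0∞) :
    (avg fun g : X → Y => F (g ∘ f)) = avg F := by
  simp only [← avg_extend hf fun g => F (g ∘ f), Function.extend_comp hf, expect_const]

lemma avg_update (x : X) (F : (X → Y) → ℝ≥0∞) :
    (avg fun g => avg fun v => F (Function.update g x v)) = avg F := by
  have hx : Function.Injective fun _ : Unit => x := Function.injective_of_subsingleton _
  have extend_eq_update (g : X → Y) (w : Unit → Y) :
      Function.extend (fun _ => x) w g = Function.update g x (w ()) := by
    funext x'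
    by_cases h : x' = x
    · subst h
      simpa using hx.extend_apply w g ()
    · simp [h, Function.extend_apply' w g x' fun ⟨_, hi⟩ => h hi.symm]
  simp only [← avg_extend hx F, extend_eq_update]
  exact congrArg avg (funext fun g =>
    (avg_bijective (Equiv.funUnique Unit Y).bijective fun v => F (Function.update g x v)).symm)

/-- A uniformly random value is hard to guess: `Λ g y` is the number of guesses at `y`, which must
not depend on the value `g x` itself, and `C` bounds the number of all guesses. -/
lemma avg_apply_le (x : X) {Λ : (X → Y) → Y → ℝ≥0∞} {C : ℝ≥0∞}
    (hΛ : ∀ g v, Λ (Function.update g x v) = Λ g) (hC : ∀ g, ∑ y, Λ g y ≤ C) :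
    (avg fun g => Λ g (g x)) ≤ C / Fintype.card Y := by
  rw [← avg_update x]
  refine expect_le_of_le _ fun g => ?_
  simp only [hΛ, Function.update_self, avg_eq, ENNReal.div_eq_inv_mul]
  gcongr
  exact hC g

open Classical in
/-- The indicator that a function is not injective. -/
noncomputable def collision (g : X → Y) : ℝ≥0∞ := if g.Injective then 0 else 1

lemma avg_collision_le : (avg fun g : X → Y => collision g) ≤
    (Fintype.card X : ℝ≥0∞) ^ 2 / Fintype.card Y := by
  classical
  have collision_le (g : X → Y) :
      collision g ≤ ∑ p ∈ Finset.univ.offDiag, if g p.1 = g p.2 then 1 else 0 := by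
    rw [collision]
    split_ifs with hg
    · exact zero_le
    · obtain ⟨x, y, hxy, hne⟩ := Function.not_injective_iff.1 hg
      calc (1 : ℝ≥0∞) = if g x = g y then 1 else 0 := by rw [if_pos hxy]
        _ ≤ _ := Finset.single_le_sum (a := (x, y)) (fun _ _ => zero_le) (by simpa using hne)
          (f := fun p : X × X => if g p.1 = g p.2 then (1 : ℝ≥0∞) else 0)
  have avg_pair_le (p : X × X) (hp : p.1 ≠ p.2) :
      (avg fun g : X → Y => if g p.1 = g p.2 then 1 else 0) ≤ 1 / Fintype.card Y :=
    avg_apply_le p.2 (Λ := fun g y => if g p.1 = y then 1 else 0)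
      (fun g v => by simp [Function.update_of_ne hp]) fun g => by simp
  calc (avg fun g : X → Y => collision g)
      ≤ ∑ p ∈ (Finset.univ : Finset X).offDiag,
          avg fun g : X → Y => if g p.1 = g p.2 then 1 else 0 :=
        (expect_mono _ collision_le).trans (expect_finset_sum _ _ _).le
    _ ≤ ∑ _p ∈ (Finset.univ : Finset X).offDiag, 1 / (Fintype.card Y : ℝ≥0∞) :=
        Finset.sum_le_sum fun p hp => avg_pair_le p (by simpa using hp)
    _ ≤ (Fintype.card X : ℝ≥0∞) ^ 2 / Fintype.card Y := by
        rw [Finset.sum_const, nsmul_eq_mul, mul_one_div, sq, ← Nat.cast_mul, Finset.offDiag_card]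
        gcongr
        exact Nat.sub_le _ _

end UniformFunctions

/-! ### Oracle computations -/

namespace OracleComp

variable {P : Params} {α β : Type}

/-- Sequential composition. -/
def bind : OracleComp P α → (α → OracleComp P β) → OracleComp P β
  | done a, f => f a
  | random μ next, f => random μ fun v => (next v).bind f
  | queryH k s next, f => queryH k s fun e => (next e).bind f
  | queryMask k i next, f => queryMask k i fun e => (next e).bind f

lemma run_bind (O : Oracles P) (m : OracleComp P α) (f : α → OracleComp P β) :
    (m.bind f).run O = (m.run O).bind fun a => (f a).run O := by
  induction m with
  | done a => simp [bind, run]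
  | random μ next ih => simp [bind, run, ih]
  | queryH k s _ ih => exact ih _
  | queryMask k i _ ih => exact ih _

open Classical in
/-- The expected number of queries, to either of the oracles, with the key `k`. -/
noncomputable def queries (O : Oracles P) (k : Key P) : OracleComp P α → ℝ≥0∞
  | done _ => 0
  | random μ next => expect μ fun v => (next v).queries O k
  | queryH k' s next => (if k' = k then 1 else 0) + (next (O.H k' s)).queries O k
  | queryMask k' i next => (if k' = k then 1 else 0) + (next (O.mask k' i)).queries O k

lemma queries_bind (O : Oracles P) (k : Key P) (m : OracleComp P α) (f : α → OracleComp P β) :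
    (m.bind f).queries O k = m.queries O k + expect (m.run O) fun a => (f a).queries O k := by
  induction m with
  | done a => simp [bind, queries, run, expect_pure]
  | random μ next ih => simp [bind, queries, run, ih, expect_add, expect_bind]
  | queryH k s next ih => simp [bind, queries, run, ih, add_assoc]
  | queryMask k i next ih => simp [bind, queries, run, ih, add_assoc]

lemma sum_queries_le (O : Oracles P) {m : OracleComp P α} {T : ℕ} (hm : m.QueryBound T) :
    ∑ k, m.queries O k ≤ T := by
  classical
  have query_le {next : OracleComp P α} (k : Key P) {T : ℕ} (hT : 0 < T)
      (ih : ∑ k', next.queries O k' ≤ (T - 1 : ℕ)) :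
      ∑ k', ((if k = k' then 1 else 0) + next.queries O k') ≤ T := by
    obtain ⟨T, rfl⟩ := Nat.exists_eq_succ_of_ne_zero hT.ne'
    simp only [Finset.sum_add_distrib, Finset.sum_ite_eq, Finset.mem_univ, if_true]
    rw [Nat.succ_eq_one_add, Nat.cast_add, Nat.cast_one]
    gcongr
    exact ih
  induction m generalizing T with
  | done a => simp [queries]
  | random μ next ih =>
    simp only [queries, ← expect_finset_sum]
    exact expect_le_of_le _ fun v => ih v (hm v)
  | queryH k s next ih => exact query_le k hm.1 (ih _ (hm.2 _))
  | queryMask k i next ih => exact query_le k hm.1 (ih _ (hm.2 _))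

variable {ι : Type*} [Fintype ι]

/-- Once the computation queries a key `b i`, its number of queries there exceeds any probability;
until then the oracles agree. -/
lemma run_le_run_add {O O' : Oracles P} (b : ι → Key P)
    (hO : ∀ k, (∀ i, b i ≠ k) → O'.H k = O.H k ∧ O'.mask k = O.mask k)
    (m : OracleComp P α) (y : α) :
    m.run O' y ≤ m.run O y + ∑ i, m.queries O (b i) := by
  classical
  have query_le {ρ : Type} (next : ρ → OracleComp P α)
      (ih : ∀ e, (next e).run O' y ≤ (next e).run O y + ∑ i, (next e).queries O (b i))
      (k : Key P) (e e' : ρ) (he : (∀ i, b i ≠ k) → e' = e) : (next e').run O' y ≤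
        (next e).run O y + ∑ i, ((if k = b i then 1 else 0) + (next e).queries O (b i)) := by
    by_cases hk : ∀ i, b i ≠ k
    · rw [he hk]
      refine (ih e).trans ?_
      gcongr
      exact le_add_self
    · obtain ⟨i, rfl⟩ := not_forall_not.1 hk
      calc (next e').run O' y ≤ 1 := PMF.coe_le_one _ _
        _ ≤ (if b i = b i then 1 else 0) + (next e).queries O (b i) := by simp
        _ ≤ ∑ j, ((if b i = b j then 1 else 0) + (next e).queries O (b j)) :=
          Finset.single_le_sum (fun _ _ => zero_le) (Finset.mem_univ i)
            (f := fun j => (if b i = b j then 1 else 0) + (next e).queries O (b j))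
        _ ≤ _ := le_add_self
  induction m with
  | done a => simp [run]
  | random μ next ih =>
    simp only [run, queries, bind_apply_eq_expect, ← expect_finset_sum, ← expect_add]
    exact expect_mono _ ih
  | queryH k s next ih => exact query_le next ih k _ _ fun hk => congrFun (hO k hk).1 s
  | queryMask k i next ih => exact query_le next ih k _ _ fun hk => congrFun (hO k hk).2 i

/-- A computation `m O` that depends on the oracles, say because it receives hash values, may be
run with oracles that are independent of what it receives, unless it queries a key `b i` at which
the oracles were reprogrammed. -/
lemma avg_run_le {Ω : Type*} [Fintype Ω] [Nonempty Ω] (b : ι → Key P)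
    {Φ : Ω → Oracles P → Oracles P}
    (hΦ : ∀ F : Oracles P → ℝ≥0∞, (avg fun O => avg fun ω => F (Φ ω O)) = avg F)
    (hb : ∀ ω O k, (∀ i, b i ≠ k) → (Φ ω O).H k = O.H k ∧ (Φ ω O).mask k = O.mask k)
    (m : Oracles P → OracleComp P α) (y : α) :
    (avg fun O => (m O).run O y) ≤
      avg fun O => avg fun ω => (m (Φ ω O)).run O y + ∑ i, (m (Φ ω O)).queries O (b i) := by
  rw [← hΦ]
  exact expect_mono _ fun O => expect_mono _ fun ω => run_le_run_add b (hb ω O) _ y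

end OracleComp

lemma abs_prob_sub_le {p q : PMF Bool} {ε : ℝ≥0∞} (hε : ε ≠ ∞) (h : ∀ y, p y ≤ q y + ε) :
    |prob p - prob q| ≤ ε.toReal := by
  have sum_eq_one (p : PMF Bool) : (p true).toReal + (p false).toReal = 1 := by
    rw [← ENNReal.toReal_add (p.apply_ne_top _) (p.apply_ne_top _), ← Fintype.sum_bool,
      ← tsum_fintype (L := .unconditional _), p.tsum_coe, ENNReal.toReal_one]
  have toReal_le (y : Bool) : (p y).toReal ≤ (q y).toReal + ε.toReal := by
    rw [← ENNReal.toReal_add (q.apply_ne_top _) hε]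
    exact ENNReal.toReal_mono (by simp [hε, q.apply_ne_top]) (h y)
  rw [prob, prob, abs_sub_le_iff]
  constructor <;> linarith [sum_eq_one p, sum_eq_one q, toReal_le true, toReal_le false]

lemma pmf_bind_eq_bind {α β : Type} (p : PMF α) (q : α → PMF β) : p >>= q = p.bind q := rfl

lemma pmf_pure_eq_pure {α : Type} (a : α) : (pure a : PMF α) = PMF.pure a := rfl

lemma uniform_bind_beq (p : PMF Bool) :
    ((PMF.uniformOfFintype Bool).bind fun b => p.bind fun y => PMF.pure (y == b)) =
      PMF.uniformOfFintype Bool := by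
  have uniform_beq (y : Bool) : ((PMF.uniformOfFintype Bool).bind fun b => PMF.pure (y == b)) =
      PMF.uniformOfFintype Bool := by
    ext z
    cases y <;> cases z <;> simp [PMF.bind_apply, PMF.pure_apply]
  simp only [PMF.bind_comm _ p, uniform_beq, PMF.bind_const]

lemma prob_uniform : prob (PMF.uniformOfFintype Bool) = 1 / 2 := by
  simp [prob]

/-! ### Correctness -/

lemma ofBits_toBits (w v : ℕ) : ofBits (toBits w v) = v % 2 ^ w := by
  have toBits_val (j : Fin w) : (toBits w v j).val = (v.testBit j).toNat := by
    cases h : v.testBit j <;> simp [toBits, h, ZMod.val_one]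
  have sum_eq {w : ℕ} (b : Fin w → Bool) : ∑ j, (b j).toNat * 2 ^ (j : ℕ) = Nat.ofBits b := by
    induction w with
    | zero => rfl
    | succ w ih =>
      simp [Fin.sum_univ_succ, Nat.ofBits_succ, ← ih, Finset.mul_sum, pow_succ', add_comm,
        mul_left_comm]
  simp only [ofBits, toBits_val]
  rw [sum_eq fun j : Fin w => v.testBit j, Nat.ofBits_testBit]

lemma ofBits_toBits_clog {N : ℕ} (i : Fin N) : ofBits (toBits (Nat.clog 2 N) i) = i := by
  rw [ofBits_toBits, Nat.mod_eq_of_lt (i.2.trans_le (Nat.le_pow_clog one_lt_two N))]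

lemma toBits_clog_injective (N : ℕ) :
    Function.Injective fun i : Fin N => toBits (Nat.clog 2 N) i :=
  fun i j (h : toBits _ _ = toBits _ _) => Fin.ext <| by
    rw [← ofBits_toBits_clog i, h, ofBits_toBits_clog j]

lemma foldl_finRange {β : Type*} {n : ℕ} {f : β → Fin n → β} {s : ℕ → β}
    (h : ∀ i : Fin n, f (s i) i = s (i + 1)) : (List.finRange n).foldl f (s 0) = s n := by
  induction n generalizing s with
  | zero => simp
  | succ n ih =>
    rw [List.finRange_succ, List.foldl_cons, List.foldl_map, show f (s 0) 0 = s 1 from h 0]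
    exact ih (f := fun b i => f b i.succ) (s := fun i => s (i + 1)) fun i => h i.succ

section Protocol

variable {P : Params}

/-- The state of the machine `M` after the first `i` symbols of `x`. -/
def trace (M : FSM P) (x : Input P) (i : ℕ) : Fin P.nQ := M.eval ((List.ofFn x).take i)

lemma trace_succ (M : FSM P) (x : Input P) (i : Fin P.n) :
    trace M x (i + 1) = M.step (trace M x i) (x i) := by
  rw [trace, List.take_succ_eq_append_getElem (by simp), DFA.eval_append_singleton, trace]
  simp

lemma result_eq_acceptBit_trace (M : FSM P) (x : Input P) :
    result M x = acceptBit M (trace M x P.n) := by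
  rw [result, trace, List.take_of_length_le (by simp)]

/-- The rotated state after `i` symbols, that is, the row of the `i`-th matrix that the client
decrypts. -/
def position (M : FSM P) (x : Input P) (rot : Fin P.n → Fin P.nQ) (i : Fin P.n) : Fin P.nQ :=
  trace M x i + rot i

/-- The plaintext that the client obtains from the `i`-th matrix, when its rotated states are `p`,
their keys are `k`, and its output share is `z`. -/
def nextEntry (z : ZMod 2) (p : Fin P.n → Fin P.nQ) (k : Fin P.n → Key P) (i : Fin P.n) :
    Entry P :=
  if h : (i : ℕ) + 1 < P.n then (toBits P.lQ (p ⟨i + 1, h⟩ : Fin P.nQ), k ⟨i + 1, h⟩)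
  else padShare z

lemma payload_position (M : FSM P) (x : Input P) (c : ServerCoins P) (i : Fin P.n) :
    payload M c i (x i) (position M x c.rot i) =
      nextEntry (c.r + result M x) (position M x c.rot) (fun j => c.k j (position M x c.rot j))
        i := by
  rw [payload, nextEntry, position, add_sub_cancel_right, ← trace_succ]
  split_ifs with h
  · rfl
  · rw [result_eq_acceptBit_trace, show (i : ℕ) + 1 = P.n by omega]

/-- The two shares select complementary sets of columns, except for the column of the client's
symbol. -/
lemma partialAnswer_helperShares (O : Oracles P) (m : SetupMsg P) (x : Input P) (a : Shares P) :
    partialAnswer O m (helperShares x a) = partialAnswer O m a + fun i => m.1 i (x i) := by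
  funext i
  have selected_column (j : Fin P.nS) : (if helperShares x a i j = 1 then m.1 i j else 0) =
      (if a i j = 1 then m.1 i j else 0) + if x i = j then m.1 i j else 0 := by
    have cases_bit (b : ZMod 2) : b = 0 ∨ b = 1 := by decide +revert
    rcases cases_bit (a i j) with ha | ha <;> by_cases hj : x i = j <;>
      simp [helperShares, oneHot, ha, hj, ZModModule.add_self]
  simp only [partialAnswer, Finset.sum_filter, selected_column, Finset.sum_add_distrib,
    Finset.sum_ite_eq, Finset.mem_univ, if_true, Pi.add_apply]
  exact add_right_comm _ _ _

lemma clientView_columns (O : Oracles P) (M : FSM P) (x : Input P) (c : ServerCoins P)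
    (a : Shares P) (i : Fin P.n) :
    (clientView O M x c a).columns i = garble O M c i (x i) := by
  simp only [ClientView.columns, clientView, partialAnswer_helperShares, Pi.add_apply, setupMsg]
  rw [← add_assoc, ZModModule.add_self, zero_add]

lemma evalStep_clientView (O : Oracles P) (M : FSM P) (x : Input P) (c : ServerCoins P)
    (a : Shares P) (i : Fin P.n) :
    let p := position M x c.rot
    let e := nextEntry (c.r + result M x) p (fun j => c.k j (p j)) i
    evalStep O (clientView O M x c a) (p i, c.k i (p i)) i =
      (Fin.ofNat P.nQ (ofBits e.1), e.2) := by
  intro p e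
  have decrypt : (clientView O M x c a).columns i (p i) + O.H (c.k i (p i)) (toBits P.lS (x i)) =
      e := by
    rw [clientView_columns, garble, payload_position, add_right_comm, ZModModule.add_self, zero_add]
  rw [← decrypt]
  rfl

lemma clientOutput_clientView (O : Oracles P) (M : FSM P) (x : Input P) (c : ServerCoins P)
    (a : Shares P) : clientOutput O (clientView O M x c a) = c.r + result M x := by
  set p := position M x c.rot with hp
  let s (i : ℕ) : Start P := if h : i < P.n then (p ⟨i, h⟩, c.k ⟨i, h⟩ (p ⟨i, h⟩))
    else (Fin.ofNat P.nQ (ofBits (0 : Bits P.lQ)), (padShare (c.r + result M x) : Entry P).2)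
  have start_eq : (clientView O M x c a).start = s 0 := by
    simp [s, Nat.pos_of_ne_zero (NeZero.ne P.n), clientView, startMsg, hp, position, trace]
  have step_eq (i : Fin P.n) : evalStep O (clientView O M x c a) (s i) i = s (i + 1) := by
    simp only [s, i.2, dif_pos, hp, evalStep_clientView, nextEntry]
    split_ifs with h
    · simp [Params.lQ, ofBits_toBits_clog]
    · rfl
  rw [clientOutput, start_eq, foldl_finRange step_eq]
  simp [s, padShare]

/-! ### Privacy against a malicious server -/

lemma MaliciousServer.game_eq_uniform (A : MaliciousServer P) :
    A.game = PMF.uniformOfFintype Bool := by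
  have guess_eq (O : Oracles P) (ch : Input P × Input P × A.State) (b : Bool) :
      ((A.exec O ch.2.2 (if b then ch.2.1 else ch.1)).bind fun out => PMF.pure (out.2 == b)) =
        ((PMF.uniformOfFintype (Shares P)).bind fun a =>
          ((A.respond ch.2.2 a).run O).map Prod.snd).bind fun y => PMF.pure (y == b) := by
    simp only [MaliciousServer.exec, pmf_bind_eq_bind, pmf_pure_eq_pure, PMF.bind_bind,
      PMF.pure_bind, PMF.bind_map, Function.comp_def]
  simp only [MaliciousServer.game, pmf_bind_eq_bind, pmf_pure_eq_pure, guess_eq, uniform_bind_beq,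
    PMF.bind_const]

end Protocol

/-! ### Memory and programs -/

lemma toBits_bijective (w : ℕ) : Function.Bijective fun v : Fin (2 ^ w) => toBits w v := by
  refine (Fintype.bijective_iff_injective_and_card _).2 ⟨fun v v' h => ?_, by simp⟩
  have h' : toBits w v = toBits w v' := h
  simpa [ofBits_toBits, Nat.mod_eq_of_lt, Fin.ext_iff] using congrArg ofBits h'

/-- The table `b` with `N` rows of length `w`, written row after row. -/
def flatten {α : Type*} {N w : ℕ} (b : Fin N → Fin w → α) : Fin (N * w) → α :=
  fun k => b k.divNat k.modNat

lemma flatten_finProdFinEquiv {α : Type*} {N w : ℕ} (b : Fin N → Fin w → α) (i : Fin N)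
    (j : Fin w) : flatten b (finProdFinEquiv (i, j)) = b i j :=
  congrArg (fun ij : Fin N × Fin w => b ij.1 ij.2) (finProdFinEquiv.symm_apply_apply (i, j))

lemma flatten_bijective (α : Type*) (N w : ℕ) :
    (flatten : (Fin N → Fin w → α) → Fin (N * w) → α).Bijective :=
  ((Equiv.curry _ _ _).symm.trans (finProdFinEquiv.arrowCongr (Equiv.refl α))).bijective

lemma row_le {N : ℕ} (i : Fin N) (w : ℕ) : i * w + w ≤ N * w := by
  rw [← Nat.succ_mul]
  exact Nat.mul_le_mul_right w i.2

namespace Mem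

variable {m m' : Mem} {a d w w' N : ℕ}

lemma read_congr (h : ∀ i < d, m' i = m i) (ha : a + w ≤ d) : m'.read a w = m.read a w :=
  funext fun j => h _ (by omega)

lemma write_of_lt (m : Mem) (b : Bits w) (h : a < d) : m.write d b a = m a := by
  simp [write, h.not_ge]

lemma write_of_le (m : Mem) (b : Bits w) (h : d + w ≤ a) : m.write d b a = m a := by
  simp [write, show ¬ a - d < w by omega]

lemma read_write_self (m : Mem) (d : ℕ) (b : Bits w) : (m.write d b).read d w = b := by
  funext j
  simp [read, write]

lemma read_write_of_le (m : Mem) (b : Bits w) (h : a + w' ≤ d) :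
    (m.write d b).read a w' = m.read a w' :=
  read_congr (fun _ hi => write_of_lt m b hi) h

lemma eq_write {b : Bits w} (h_lt : ∀ a < d, m' a = m a) (h_read : m'.read d w = b)
    (h_le : ∀ a, d + w ≤ a → m' a = m a) : m' = m.write d b := by
  funext a
  rcases lt_or_ge a d with ha | ha
  · rw [h_lt a ha, write_of_lt m b ha]
  obtain ⟨j, rfl⟩ := Nat.exists_eq_add_of_le ha
  rcases lt_or_ge j w with hj | hj
  · exact congrFun (h_read.trans (read_write_self m d b).symm) ⟨j, hj⟩
  · rw [h_le _ (by omega), write_of_le m b (by omega)]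

lemma read_eq_flatten_iff {b : Fin N → Bits w} :
    m.read d (N * w) = flatten b ↔ ∀ i : Fin N, m.read (d + i * w) w = b i := by
  simp only [funext_iff, ← finProdFinEquiv.forall_congr_right (β := Fin (N * w)), Prod.forall,
    flatten_finProdFinEquiv, read, finProdFinEquiv_apply_val, add_assoc, mul_comm,
    Nat.add_comm (Fin.val (n := w) _)]

lemma write_flatten_snoc (m : Mem) (d : ℕ) (b : Fin N → Bits w) (c : Bits w) :
    (m.write d (flatten b)).write (d + N * w) c =
      m.write d (flatten (Fin.snoc b c : Fin (N + 1) → Bits w)) := by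
  refine eq_write (fun a ha => ?_) (read_eq_flatten_iff.2 fun i => ?_) fun a ha => ?_
  · rw [write_of_lt _ c (by omega), write_of_lt m _ ha]
  · cases i using Fin.lastCases with
    | last => rw [Fin.val_last, read_write_self, Fin.snoc_last]
    | cast i =>
      have := row_le i w
      rw [Fin.val_castSucc, read_write_of_le _ c (by omega), Fin.snoc_castSucc]
      exact read_eq_flatten_iff.1 (read_write_self m d _) i
  · rw [Nat.succ_mul] at ha
    rw [write_of_le _ c (by omega), write_of_le m _ (by omega)]

end Mem

section Programs

variable {P : Params} (O : Oracles P) {N d w : ℕ}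

lemma execProg_append (prog prog' : List Instr) (m : Mem) :
    execProg O (prog ++ prog') m = (execProg O prog m).bind (execProg O prog') := by
  induction prog generalizing m with
  | nil => simp [execProg]
  | cons I prog ih => simp [execProg, ih]

lemma execProg_singleton (I : Instr) (m : Mem) : execProg O [I] m = I.exec O m := by
  simp [execProg]

lemma exec_uniform (d : ℕ) [NeZero N] (m : Mem) :
    (Instr.uniform d (N - 1)).exec O m = (PMF.uniformOfFintype (Fin N)).map
      fun v : Fin N => m.write d (toBits (Nat.clog 2 N) v) := by
  cases N with
  | zero => exact absurd rfl (NeZero.ne 0)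
  | succ N => simp [Instr.exec, PMF.monad_map_eq_map, PMF.map_comp, Function.comp_def]

lemma expect_exec_uniform_two_pow (d w : ℕ) (m : Mem) (F : Mem → ℝ≥0∞) :
    expect ((Instr.uniform d (2 ^ w - 1)).exec O m) F = avg fun b : Bits w => F (m.write d b) := by
  rw [exec_uniform, expect_map, Nat.clog_pow 2 w one_lt_two]
  exact avg_bijective (toBits_bijective w) fun b => F (m.write d b)

lemma expect_execProg_uniform_loop {u : ℕ} [NeZero u] (F : Mem → ℝ≥0∞) (m : Mem) :
    expect (execProg O ((List.finRange N).map fun i : Fin N =>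
        Instr.uniform (d + i * Nat.clog 2 u) (u - 1)) m) F =
      avg fun g : Fin N → Fin u =>
        F (m.write d (flatten fun i => toBits (Nat.clog 2 u) (g i))) := by
  induction N generalizing F with
  | zero =>
    have write_empty (g : Fin 0 → Fin u) :
        m.write d (flatten fun i => toBits (Nat.clog 2 u) (g i)) = m :=
      (Mem.eq_write (fun _ _ => rfl) (Mem.read_eq_flatten_iff.2 fun i => i.elim0)
        fun _ _ => rfl).symm
    simp [execProg, expect_pure, write_empty, expect_const]
  | succ N ih =>
    rw [List.finRange_succ_last, List.map_append, List.map_map, execProg_append, expect_bind]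
    simp only [List.map_singleton, execProg_singleton, exec_uniform, expect_map, Fin.val_last]
    refine (ih _).trans ?_
    rw [avg, expect_comm,
      ← avg_bijective (Fin.snocEquiv fun _ : Fin (N + 1) => Fin u).bijective, avg_prod]
    refine congrArg _ (funext fun v => congrArg _ (funext fun g => congrArg F ?_))
    rw [Mem.write_flatten_snoc]
    congr 2
    exact (Fin.comp_snoc (fun v : Fin u => toBits (Nat.clog 2 u) v) g v).symm

/-- Started with the memory `m`, the program writes the string `b` from address `d` on, and does
not change the memory below `d`. -/
def Writes (prog : List Instr) (m : Mem) (d : ℕ) (b : Bits w) : Prop :=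
  ∃ m', execProg O prog m = PMF.pure m' ∧ (∀ a < d, m' a = m a) ∧ m'.read d w = b

variable {O} {m : Mem}

lemma Writes.flatMap_finRange {prog : Fin N → List Instr} {b : Fin N → Bits w}
    (h : ∀ i m', (∀ a < d, m' a = m a) → Writes O (prog i) m' (d + i * w) (b i)) :
    Writes O ((List.finRange N).flatMap prog) m d (flatten b) := by
  induction N with
  | zero =>
    exact ⟨m, by simp [execProg], fun _ _ => rfl, Mem.read_eq_flatten_iff.2 fun i => i.elim0⟩
  | succ N ih =>
    obtain ⟨m₁, h_exec, h_lt, h_read⟩ := ih fun i => h i.castSucc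
    obtain ⟨m₂, h_exec', h_lt', h_read'⟩ := h (Fin.last N) m₁ h_lt
    refine ⟨m₂, ?_, fun a ha => ?_, Mem.read_eq_flatten_iff.2 fun i => ?_⟩
    · rw [List.finRange_succ_last, List.flatMap_append, List.flatMap_map, execProg_append, h_exec,
        PMF.pure_bind, List.flatMap_singleton, h_exec']
    · rw [h_lt' a (by omega), h_lt a ha]
    · cases i using Fin.lastCases with
      | last => exact h_read'
      | cast i =>
        have := row_le i w
        rw [← Mem.read_eq_flatten_iff.1 h_read i]
        exact Mem.read_congr h_lt' (by rw [Fin.val_last, Fin.val_castSucc]; omega)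

end Programs

/-! ### Boolean circuits as programs -/

/-- Boolean circuits over the bits of the memory, as arithmetic expressions over `ZMod 2`. -/
inductive BitExpr : Type
  | var (a : ℕ)
  | const (c : ZMod 2)
  | add (e f : BitExpr)
  | mul (e f : BitExpr)

namespace BitExpr

/-- The value of an expression, `var a` being the bit at address `a`. -/
def eval (m : Mem) : BitExpr → ZMod 2
  | var a => m a
  | const c => c
  | add e f => e.eval m + f.eval m
  | mul e f => e.eval m * f.eval m

/-- The expression reads addresses below `d` only. -/
def Below (d : ℕ) : BitExpr → Prop
  | var a => a < d
  | const _ => True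
  | add e f => e.Below d ∧ f.Below d
  | mul e f => e.Below d ∧ f.Below d

/-- The number of variables, constants and operations. -/
def size : BitExpr → ℕ
  | var _ => 1
  | const _ => 1
  | add e f => e.size + f.size + 1
  | mul e f => e.size + f.size + 1

/-- A program that computes the expression at address `d`, with the addresses above `d` as a
stack. There is no instruction that writes the bit `0`; hence the `xor` of a bit with itself. -/
def compile : BitExpr → ℕ → List Instr
  | var a, d => [.and d a a]
  | const c, d => [if c = 1 then .one d else .xor d d d]
  | add e f, d => e.compile d ++ f.compile (d + 1) ++ [.xor d d (d + 1)]
  | mul e f, d => e.compile d ++ f.compile (d + 1) ++ [.and d d (d + 1)]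

variable {e f : BitExpr} {d d' K : ℕ} {m m' : Mem}

lemma Below.mono (h : e.Below d) (hd : d ≤ d') : e.Below d' := by
  induction e with
  | var a => exact lt_of_lt_of_le h hd
  | const c => trivial
  | add e f ihe ihf => exact ⟨ihe h.1, ihf h.2⟩
  | mul e f ihe ihf => exact ⟨ihe h.1, ihf h.2⟩

lemma eval_congr (h : e.Below d) (hm : ∀ a < d, m' a = m a) : e.eval m' = e.eval m := by
  induction e with
  | var a => exact hm a h
  | const c => rfl
  | add e f ihe ihf => rw [eval, eval, ihe h.1, ihf h.2]
  | mul e f ihe ihf => rw [eval, eval, ihe h.1, ihf h.2]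

lemma cost_compile (P : Params) (e : BitExpr) (d : ℕ) :
    ((e.compile d).map (Instr.cost P)).sum = e.size := by
  induction e generalizing d with
  | var a => rfl
  | const c => by_cases hc : c = 1 <;> simp [compile, size, hc, Instr.cost]
  | add e f ihe ihf => simp [compile, size, ihe, ihf, Instr.cost, add_assoc]
  | mul e f ihe ihf => simp [compile, size, ihe, ihf, Instr.cost, add_assoc]

section Writes

variable {P : Params} {O : Oracles P}

lemma writes_singleton {I : Instr} {b : ZMod 2}
    (hI : I.exec O m = PMF.pure (Function.update m d b)) :
    Writes O [I] m d fun _ : Fin 1 => b := by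
  refine ⟨_, (execProg_singleton O I m).trans hI, fun a ha => ?_, funext fun j => ?_⟩
  · exact Function.update_of_ne ha.ne _ _
  · simp [Mem.read]

lemma writes_binary {prog prog' : List Instr} {I : Instr} {op : ZMod 2 → ZMod 2 → ZMod 2}
    {b c : ZMod 2} (h : Writes O prog m d fun _ : Fin 1 => b)
    (h' : ∀ m', (∀ a < d, m' a = m a) → Writes O prog' m' (d + 1) fun _ : Fin 1 => c)
    (hI : ∀ m, I.exec O m = PMF.pure (Function.update m d (op (m d) (m (d + 1))))) :
    Writes O (prog ++ prog' ++ [I]) m d fun _ : Fin 1 => op b c := by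
  obtain ⟨m₁, h_exec, h_lt, h_read⟩ := h
  obtain ⟨m₂, h_exec', h_lt', h_read'⟩ := h' m₁ h_lt
  have h_left : m₂ d = b := (h_lt' d (by omega)).trans (congrFun h_read 0)
  have h_right : m₂ (d + 1) = c := congrFun h_read' 0
  obtain ⟨m₃, h_exec'', h_lt'', h_read''⟩ := writes_singleton (hI m₂)
  refine ⟨m₃, ?_, fun a ha => ?_, by rw [h_read'', h_left, h_right]⟩
  · rw [execProg_append, execProg_append, h_exec, PMF.pure_bind, h_exec', PMF.pure_bind, h_exec'']
  · rw [h_lt'' a ha, h_lt' a (by omega), h_lt a ha]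

lemma writes_compile (h : e.Below d) : Writes O (e.compile d) m d fun _ : Fin 1 => e.eval m := by
  have mul_self (b : ZMod 2) : b * b = b := by decide +revert
  have eq_zero {c : ZMod 2} (hc : c ≠ 1) : c = 0 := by decide +revert
  induction e generalizing d m with
  | var a =>
    have h := writes_singleton (O := O) (m := m) (I := .and d a a) rfl
    rwa [mul_self] at h
  | const c =>
    refine writes_singleton ?_
    split_ifs with hc
    · rw [hc, eval, Instr.exec]
    · rw [eq_zero hc, eval, Instr.exec, ZModModule.add_self]
  | add e f ihe ihf =>
    refine writes_binary (op := (· + ·)) (ihe h.1) (fun m' hm' => ?_) fun _ => rfl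
    rw [← eval_congr h.2 hm']
    exact ihf (h.2.mono d.le_succ)
  | mul e f ihe ihf =>
    refine writes_binary (op := (· * ·)) (ihe h.1) (fun m' hm' => ?_) fun _ => rfl
    rw [← eval_congr h.2 hm']
    exact ihf (h.2.mono d.le_succ)

end Writes

/-- A program that computes the expressions of a family at consecutive addresses from `d` on. -/
def compileAll (e : Fin K → BitExpr) (d : ℕ) : List Instr :=
  (List.finRange K).flatMap fun k => (e k).compile (d + k)

lemma writes_compileAll {P : Params} {O : Oracles P} {e : Fin K → BitExpr}
    (h : ∀ k, (e k).Below d) : Writes O (compileAll e d) m d fun k => (e k).eval m := by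
  have h_writes (k : Fin K) (m' : Mem) (hm' : ∀ a < d, m' a = m a) :
      Writes O ((e k).compile (d + k)) m' (d + k * 1) fun _ : Fin 1 => (e k).eval m := by
    rw [mul_one, ← eval_congr (h k) hm']
    exact writes_compile ((h k).mono (d.le_add_right k))
  obtain ⟨m', h_exec, h_lt, h_read⟩ := Writes.flatMap_finRange h_writes
  refine ⟨m', h_exec, h_lt, funext fun k => ?_⟩
  have h_bit := congrFun (Mem.read_eq_flatten_iff.1 h_read k) 0
  rwa [mul_one] at h_bit

lemma cost_compileAll (P : Params) (e : Fin K → BitExpr) (d : ℕ) :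
    ((compileAll e d).map (Instr.cost P)).sum = ∑ k, (e k).size := by
  simp [compileAll, List.flatMap_def, List.map_flatten, List.sum_flatten, Function.comp_def,
    cost_compile, Fin.sum_univ_def]

/-- The indicator of the string from address `a` on being equal to `b`. -/
def eqConst (a : ℕ) : {w : ℕ} → Bits w → BitExpr
  | 0, _ => const 1
  | w + 1, b => mul (eqConst a (Fin.init b)) (add (var (a + w)) (const (b (Fin.last w) + 1)))

lemma size_eqConst {w : ℕ} (a : ℕ) (b : Bits w) : (eqConst a b).size = 4 * w + 1 := by
  induction w with
  | zero => rfl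
  | succ w ih =>
    simp only [eqConst, size, ih]
    ring

lemma below_eqConst {a w : ℕ} (b : Bits w) (h : a + w ≤ d) : (eqConst a b).Below d := by
  induction w with
  | zero => trivial
  | succ w ih => exact ⟨ih _ (by omega), show a + w < d by omega, trivial⟩

lemma eval_eqConst {a w : ℕ} (m : Mem) (b : Bits w) :
    (eqConst a b).eval m = if m.read a w = b then 1 else 0 := by
  induction w with
  | zero => simp [eqConst, eval, Subsingleton.elim (m.read a 0) b]
  | succ w ih =>
    have add_one_eq (b c : ZMod 2) : b + (c + 1) = if b = c then 1 else 0 := by decide +revert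
    have read_succ : m.read a (w + 1) = b ↔
        m.read a w = Fin.init b ∧ m (a + w) = b (Fin.last w) := by
      simp [funext_iff, Fin.forall_fin_succ', Mem.read, Fin.init]
    simp only [eqConst, eval, ih, add_one_eq, read_succ, ite_and, mul_ite, mul_one, mul_zero]
    split_ifs <;> rfl

end BitExpr

/-! ### The simulator for the client -/

namespace Params

variable (P : Params)

/-- Bit length of an entry. -/
abbrev lE : ℕ := P.lQ + P.κ

/-- Address of the simulated keys. The share `z` and the input occupy the addresses below. -/
def adrKey : ℕ := 1 + P.n * P.lS

/-- Address of the simulated rotated states. -/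
def adrState : ℕ := P.adrKey + P.n * P.κ

/-- Address of the random rows, which replace the rows that the client cannot decrypt. -/
def adrRow : ℕ := P.adrState + P.n * P.lQ

/-- Address of the simulated answer of the server. -/
def adrAns : ℕ := P.adrRow + P.n * (P.nQ * P.lE)

/-- Address of the simulated coins of the client. -/
def adrCoins : ℕ := P.adrAns + P.n * (P.nQ * P.lE)

/-- Address of the hash values that encrypt the rows that the client decrypts. -/
def adrHash : ℕ := P.adrCoins + P.n * P.nS

/-- Address of the simulated answer of the helper. -/
def adrOut : ℕ := P.adrHash + P.n * P.lE

/-- The bits of the plaintext that the client obtains at position `i`; see `nextEntry`. -/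
def nextExpr (i : Fin P.n) : Fin P.lE → BitExpr :=
  if (i : ℕ) + 1 < P.n then
    Fin.append (fun j => .var (P.adrState + (i + 1) * P.lQ + j))
      (fun j => .var (P.adrKey + (i + 1) * P.κ + j))
  else Fin.append (fun _ => .const 0) (fun j => if j = 0 then .var 0 else .const 0)

/-- The bits of row `q` in the simulated answer of the helper for position `i`: the mask, plus
either a random row or, where `q` is the rotated state, the encrypted plaintext. -/
def cellExpr (i : Fin P.n) (q : Fin P.nQ) (j : Fin P.lE) : BitExpr :=
  .add (.var (P.adrAns + i * (P.nQ * P.lE) + q * P.lE + j))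
    (.add (.var (P.adrRow + i * (P.nQ * P.lE) + q * P.lE + j))
      (.mul (.eqConst (P.adrState + i * P.lQ) (toBits P.lQ q))
        (.add (.var (P.adrRow + i * (P.nQ * P.lE) + q * P.lE + j))
          (.add (.var (P.adrHash + i * P.lE + j)) (P.nextExpr i j)))))

/-- The bits of the simulated answer of the helper. -/
def outExpr : Fin (P.n * (P.nQ * P.lE)) → BitExpr :=
  flatten fun i => flatten fun q => P.cellExpr i q

/-- A program that samples the rotated states. -/
def sampleStates : List Instr :=
  (List.finRange P.n).map fun i : Fin P.n => .uniform (P.adrState + i * P.lQ) (P.nQ - 1)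

/-- A program that computes the hash values that encrypt the rows that the client decrypts. -/
def hashes : List Instr :=
  (List.finRange P.n).flatMap fun i : Fin P.n =>
    [.hash (P.adrHash + i * P.lE) (P.adrKey + i * P.κ) (1 + i * P.lS)]

/-- The simulator for the client. It samples the keys and rotated states along the path of the
client, the rows off that path, the answer of the server and the coins of the client, and computes
the answer of the helper that lets the client decrypt `z` at the end of the path. -/
def simulator : Simulator P where
  prog := .uniform P.adrKey (2 ^ (P.n * P.κ) - 1) :: (P.sampleStates ++
    .uniform P.adrRow (2 ^ (P.n * (P.nQ * P.lE)) - 1) ::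
    .uniform P.adrAns (2 ^ (P.n * (P.nQ * P.lE)) - 1) ::
    .uniform P.adrCoins (2 ^ (P.n * P.nS) - 1) ::
    (P.hashes ++ BitExpr.compileAll P.outExpr P.adrOut))
  coins := fun i j => P.adrCoins + i * P.nS + j
  ansS := fun i q => P.adrAns + i * (P.nQ * P.lE) + q * P.lE
  startState := P.adrState
  startKey := P.adrKey
  ansH := fun i q => P.adrOut + i * (P.nQ * P.lE) + q * P.lE

lemma size_nextExpr (i : Fin P.n) (j : Fin P.lE) : (P.nextExpr i j).size = 1 := by
  refine Fin.addCases (fun j => ?_) (fun j => ?_) j <;> rw [nextExpr] <;> split_ifs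
  · rw [Fin.append_left, BitExpr.size]
  · rw [Fin.append_left, BitExpr.size]
  · rw [Fin.append_right, BitExpr.size]
  · rw [Fin.append_right]
    split_ifs <;> rfl

lemma size_cellExpr (i : Fin P.n) (q : Fin P.nQ) (j : Fin P.lE) :
    (P.cellExpr i q j).size = 4 * P.lQ + 11 := by
  simp only [cellExpr, BitExpr.size, BitExpr.size_eqConst, size_nextExpr]
  ring

lemma cost_simulator : P.simulator.cost =
    P.n * P.κ + 1 + P.n * (P.lQ + 1) + 2 * (P.n * (P.nQ * P.lE) + 1) + (P.n * P.nS + 1) +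
      P.n * (P.κ + P.lS + P.lE + 1) + P.n * (P.nQ * P.lE) * (4 * P.lQ + 11) := by
  have cost_uniform (d w : ℕ) : (Instr.uniform d (2 ^ w - 1)).cost P = w + 1 := by
    rw [Instr.cost, Nat.sub_add_cancel Nat.one_le_two_pow, Nat.clog_pow 2 w one_lt_two]
  have cost_sampleStates : (P.sampleStates.map (Instr.cost P)).sum = P.n * (P.lQ + 1) := by
    simp [sampleStates, Function.comp_def, Instr.cost, lQ,
      Nat.sub_add_cancel (Nat.pos_of_ne_zero (NeZero.ne P.nQ))]
  have cost_hashes : (P.hashes.map (Instr.cost P)).sum = P.n * (P.κ + P.lS + P.lE + 1) := by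
    simp [hashes, List.flatMap_def, List.map_flatten, Function.comp_def,
      Instr.cost, lE]
  have size_outExpr (k : Fin (P.n * (P.nQ * P.lE))) : (P.outExpr k).size = 4 * P.lQ + 11 :=
    P.size_cellExpr _ _ _
  simp only [Simulator.cost, simulator, List.map_cons, List.map_append, List.sum_cons,
    List.sum_append, cost_uniform, cost_sampleStates, cost_hashes, BitExpr.cost_compileAll,
    size_outExpr, Finset.sum_const, Finset.card_univ, Fintype.card_fin, smul_eq_mul]
  ring

lemma cost_simulator_le : P.simulator.cost ≤ (P.size + 2) ^ 5 := by
  have clog_le (N : ℕ) : Nat.clog 2 N ≤ N := Nat.clog_le_of_le_pow Nat.lt_two_pow_self.le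
  have lQ_le : P.lQ ≤ P.nQ := clog_le _
  have lS_le : P.lS ≤ P.nS := clog_le _
  have lE_eq : P.lE = P.lQ + P.κ := rfl
  have size_eq : P.size = P.κ + P.nQ + P.nS + P.n := rfl
  rw [cost_simulator]
  generalize P.size = s at *
  calc
    _ ≤ s * s + 1 + s * (s + 1) + 2 * (s * (s * s) + 1) + (s * s + 1) + s * (2 * s + 1) +
          s * (s * s) * (4 * s + 11) := by
        gcongr <;> omega
    _ ≤ _ + (s ^ 5 + 6 * s ^ 4 + 27 * s ^ 3 + 75 * s ^ 2 + 78 * s + 28) := Nat.le_add_right _ _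
    _ = (s + 2) ^ 5 := by ring

end Params

section Simulator

variable {P : Params} {O : Oracles P} {x : Input P} {z : ZMod 2}

/-- The bits of an entry, those of the state field first. -/
def Entry.bits (e : Entry P) : Bits P.lE := Fin.append e.1 e.2

lemma Entry.bits_bijective : (Entry.bits : Entry P → Bits P.lE).Bijective :=
  (Fin.appendEquiv P.lQ P.κ).bijective

lemma Entry.bits_add (e f : Entry P) : (e + f).bits = e.bits + f.bits := by
  refine funext (Fin.addCases (fun j => ?_) fun j => ?_) <;> simp [Entry.bits]

/-- The bits of a table of entries. -/
def answerBits (R : Answer P) : Bits (P.n * (P.nQ * P.lE)) :=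
  flatten fun i => flatten fun q => (R i q).bits

lemma answerBits_bijective : (answerBits : Answer P → _).Bijective :=
  (flatten_bijective _ _ _).comp
    ((flatten_bijective _ _ _).comp Entry.bits_bijective.comp_left).comp_left

lemma Mem.read_eq_bits_iff {m : Mem} {d : ℕ} {e : Entry P} :
    m.read d P.lE = e.bits ↔ (m.read d P.lQ, m.read (d + P.lQ) P.κ) = e := by
  rw [← Entry.bits_bijective.injective.eq_iff]
  have read_eq_append : m.read d P.lE = Entry.bits (m.read d P.lQ, m.read (d + P.lQ) P.κ) :=
    funext (Fin.addCases (fun j => by simp [Entry.bits, Mem.read])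
      fun j => by simp [Entry.bits, Mem.read, add_assoc])
  rw [read_eq_append]

lemma Mem.read_eq_answerBits_iff {m : Mem} {d : ℕ} {R : Answer P} :
    m.read d (P.n * (P.nQ * P.lE)) = answerBits R ↔
      ∀ (i : Fin P.n) (q : Fin P.nQ),
        m.read (d + i * (P.nQ * P.lE) + q * P.lE) P.lE = (R i q).bits := by
  simp only [answerBits, Mem.read_eq_flatten_iff]

lemma Mem.writeEntry_eq_write (m : Mem) (d : ℕ) (e : Entry P) :
    m.writeEntry d e = m.write d e.bits := by
  have h_lE : P.lE = P.lQ + P.κ := rfl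
  refine Mem.eq_write (fun a ha => ?_) (Mem.read_eq_bits_iff.2 (Prod.ext ?_ ?_)) fun a ha => ?_
  · rw [Mem.writeEntry, Mem.write_of_lt _ _ (by omega), Mem.write_of_lt _ _ ha]
  · rw [Mem.writeEntry, Mem.read_write_of_le _ _ le_rfl, Mem.read_write_self]
  · rw [Mem.writeEntry, Mem.read_write_self]
  · rw [Mem.writeEntry, Mem.write_of_le _ _ (by omega), Mem.write_of_le _ _ (by omega)]

lemma read_loadInput (x : Input P) (z : ZMod 2) :
    (loadInput x z).read 1 (P.n * P.lS) = flatten fun i => toBits P.lS (x i) := by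
  funext k
  have hk : (k : ℕ) / P.lS < P.n := k.divNat.2
  simp only [Mem.read, add_comm 1, loadInput, hk, dif_pos]
  rfl

/-- The random values of the simulator: the keys `k` and the rotated states `p` along the path that
the client follows, the rows `R` off that path, the answer `ansS` of the server, and the client's
coins `a`. -/
structure SimCoins (P : Params) where
  k : Fin P.n → Key P
  p : Fin P.n → Fin P.nQ
  R : Answer P
  ansS : Answer P
  a : Shares P

/-- The simulated columns, in which the client can decrypt the rows along its path. -/
def simColumns (O : Oracles P) (x : Input P) (z : ZMod 2) (s : SimCoins P) : Answer P :=
  fun i q => if q = s.p i then O.H (s.k i) (toBits P.lS (x i)) + nextEntry z s.p s.k i else s.R i q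

/-- The simulated view of the client. -/
def simView (O : Oracles P) (x : Input P) (z : ZMod 2) (s : SimCoins P) : ClientView P where
  x := x
  coins := s.a
  ansS := s.ansS
  start := (s.p 0, s.k 0)
  ansH := s.ansS + simColumns O x z s

/-- The memory `m` contains the input and the random values of the simulator. -/
structure Loaded (x : Input P) (z : ZMod 2) (s : SimCoins P) (m : Mem) : Prop where
  share : m 0 = z
  input : m.read 1 (P.n * P.lS) = flatten fun i => toBits P.lS (x i)
  key : m.read P.adrKey (P.n * P.κ) = flatten s.k
  state : m.read P.adrState (P.n * P.lQ) = flatten fun i => toBits P.lQ (s.p i)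
  row : m.read P.adrRow (P.n * (P.nQ * P.lE)) = answerBits s.R
  ans : m.read P.adrAns (P.n * (P.nQ * P.lE)) = answerBits s.ansS
  coins : m.read P.adrCoins (P.n * P.nS) = flatten s.a

/-- The memory after the samplings. -/
def SimCoins.load (x : Input P) (z : ZMod 2) (s : SimCoins P) : Mem :=
  (((((loadInput x z).write P.adrKey (flatten s.k)).write
    P.adrState (flatten fun i => toBits P.lQ (s.p i))).write P.adrRow (answerBits s.R)).write
    P.adrAns (answerBits s.ansS)).write P.adrCoins (flatten s.a)

lemma SimCoins.loaded_load (x : Input P) (z : ZMod 2) (s : SimCoins P) :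
    Loaded x z s (s.load x z) := by
  have h_key : P.adrKey = 1 + P.n * P.lS := rfl
  have h_state : P.adrState = P.adrKey + P.n * P.κ := rfl
  have h_row : P.adrRow = P.adrState + P.n * P.lQ := rfl
  have h_ans : P.adrAns = P.adrRow + P.n * (P.nQ * P.lE) := rfl
  have h_coins : P.adrCoins = P.adrAns + P.n * (P.nQ * P.lE) := rfl
  constructor
  · simp (disch := omega) only [load, Mem.write_of_lt]
    rfl
  all_goals simp (disch := omega) only [load, Mem.read_write_of_le, Mem.read_write_self]
  exact read_loadInput x z

variable {s : SimCoins P} {m m' : Mem}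

lemma Loaded.congr (h : Loaded x z s m) (hm : ∀ a < P.adrHash, m' a = m a) : Loaded x z s m' := by
  have h_read {a w : ℕ} (ha : a + w ≤ P.adrHash) : m'.read a w = m.read a w := Mem.read_congr hm ha
  have h_key : P.adrKey = 1 + P.n * P.lS := rfl
  have h_state : P.adrState = P.adrKey + P.n * P.κ := rfl
  have h_row : P.adrRow = P.adrState + P.n * P.lQ := rfl
  have h_ans : P.adrAns = P.adrRow + P.n * (P.nQ * P.lE) := rfl
  have h_coins : P.adrCoins = P.adrAns + P.n * (P.nQ * P.lE) := rfl
  have h_hash : P.adrHash = P.adrCoins + P.n * P.nS := rfl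
  exact ⟨(hm 0 (by omega)).trans h.share, (h_read (by omega)).trans h.input,
    (h_read (by omega)).trans h.key, (h_read (by omega)).trans h.state,
    (h_read (by omega)).trans h.row, (h_read (by omega)).trans h.ans,
    (h_read (by omega)).trans h.coins⟩

lemma writes_hashes (h : Loaded x z s m) : Writes O P.hashes m P.adrHash
    (flatten fun i => (O.H (s.k i) (toBits P.lS (x i))).bits) := by
  refine Writes.flatMap_finRange fun i m' hm' => ?_
  have read_key := Mem.read_eq_flatten_iff.1 (h.congr hm').key i
  have read_input := Mem.read_eq_flatten_iff.1 (h.congr hm').input i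
  refine ⟨_, by rw [execProg_singleton, Instr.exec], fun a ha => ?_, ?_⟩
  · rw [Mem.writeEntry_eq_write, Mem.write_of_lt _ _ ha]
  · rw [Mem.writeEntry_eq_write, Mem.read_write_self, read_key, read_input]

lemma below_nextExpr (i : Fin P.n) (j : Fin P.lE) : (P.nextExpr i j).Below P.adrRow := by
  have h_key : P.adrKey = 1 + P.n * P.lS := rfl
  have h_state : P.adrState = P.adrKey + P.n * P.κ := rfl
  have h_row : P.adrRow = P.adrState + P.n * P.lQ := rfl
  refine Fin.addCases (fun j => ?_) (fun j => ?_) j <;> rw [Params.nextExpr] <;> split_ifs with h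
  · have := row_le ⟨i + 1, h⟩ P.lQ
    rw [Fin.append_left]
    exact show _ < _ by dsimp only at this; omega
  · rw [Fin.append_left]
    trivial
  · have := row_le ⟨i + 1, h⟩ P.κ
    rw [Fin.append_right]
    exact show _ < _ by dsimp only at this; omega
  · rw [Fin.append_right]
    split_ifs
    · exact show _ < _ by omega
    · trivial

lemma below_cellExpr (i : Fin P.n) (q : Fin P.nQ) (j : Fin P.lE) :
    (P.cellExpr i q j).Below P.adrOut := by
  have h_row : P.adrRow = P.adrState + P.n * P.lQ := rfl
  have h_ans : P.adrAns = P.adrRow + P.n * (P.nQ * P.lE) := rfl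
  have h_coins : P.adrCoins = P.adrAns + P.n * (P.nQ * P.lE) := rfl
  have h_hash : P.adrHash = P.adrCoins + P.n * P.nS := rfl
  have h_out : P.adrOut = P.adrHash + P.n * P.lE := rfl
  have := row_le i P.lQ
  have := row_le i P.lE
  have := row_le i (P.nQ * P.lE)
  have := row_le q P.lE
  refine ⟨?_, ?_, BitExpr.below_eqConst _ (by omega), ?_, ?_,
    (below_nextExpr i j).mono (by omega)⟩ <;> exact show _ < _ by omega

lemma eval_nextExpr (h : Loaded x z s m) (i : Fin P.n) (j : Fin P.lE) :
    (P.nextExpr i j).eval m = (nextEntry z s.p s.k i).bits j := by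
  refine Fin.addCases (fun j => ?_) (fun j => ?_) j <;>
    rw [Params.nextExpr, nextEntry] <;> split_ifs with hi
  · rw [Fin.append_left, Entry.bits, Fin.append_left]
    exact congrFun (Mem.read_eq_flatten_iff.1 h.state ⟨i + 1, hi⟩) j
  · rw [Fin.append_left, Entry.bits, Fin.append_left]
    rfl
  · rw [Fin.append_right, Entry.bits, Fin.append_right]
    exact congrFun (Mem.read_eq_flatten_iff.1 h.key ⟨i + 1, hi⟩) j
  · rw [Fin.append_right, Entry.bits, Fin.append_right, padShare]
    dsimp only
    split_ifs
    · exact h.share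
    · rfl

lemma eval_cellExpr (h : Loaded x z s m)
    (h_hash : m.read P.adrHash (P.n * P.lE) =
      flatten fun i => (O.H (s.k i) (toBits P.lS (x i))).bits)
    (i : Fin P.n) (q : Fin P.nQ) (j : Fin P.lE) :
    (P.cellExpr i q j).eval m = ((s.ansS + simColumns O x z s) i q).bits j := by
  have eval_ans : m (P.adrAns + i * (P.nQ * P.lE) + q * P.lE + j) = (s.ansS i q).bits j :=
    congrFun (Mem.read_eq_answerBits_iff.1 h.ans i q) j
  have eval_row : m (P.adrRow + i * (P.nQ * P.lE) + q * P.lE + j) = (s.R i q).bits j :=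
    congrFun (Mem.read_eq_answerBits_iff.1 h.row i q) j
  have eval_hash : m (P.adrHash + i * P.lE + j) = (O.H (s.k i) (toBits P.lS (x i))).bits j :=
    congrFun (Mem.read_eq_flatten_iff.1 h_hash i) j
  have read_state_iff : m.read (P.adrState + i * P.lQ) P.lQ = toBits P.lQ q ↔ q = s.p i := by
    rw [Mem.read_eq_flatten_iff.1 h.state i]
    exact (toBits_clog_injective P.nQ).eq_iff.trans eq_comm
  simp only [Params.cellExpr, BitExpr.eval, eval_ans, eval_row, eval_hash, eval_nextExpr h,
    BitExpr.eval_eqConst, read_state_iff, Pi.add_apply, Entry.bits_add, simColumns]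
  split_ifs
  · rw [one_mul, ← add_assoc ((s.R i q).bits j), ZModModule.add_self, zero_add, Entry.bits_add,
      Pi.add_apply]
  · rw [zero_mul, add_zero]

lemma view_of_loaded (h : Loaded x z s m)
    (h_out : m.read P.adrOut (P.n * (P.nQ * P.lE)) =
      answerBits (s.ansS + simColumns O x z s)) :
    P.simulator.view x m = simView O x z s := by
  have read_state : m.read P.adrState P.lQ = toBits P.lQ (s.p 0) := by
    simpa using Mem.read_eq_flatten_iff.1 h.state 0
  have read_key : m.read P.adrKey P.κ = s.k 0 := by simpa using Mem.read_eq_flatten_iff.1 h.key 0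
  simp only [Simulator.view, simView, Params.simulator, ClientView.mk.injEq, true_and]
  refine ⟨?_, ?_, Prod.ext ?_ read_key, ?_⟩
  · exact funext fun i => Mem.read_eq_flatten_iff.1 h.coins i
  · exact funext₂ fun i q => Mem.read_eq_bits_iff.1 (Mem.read_eq_answerBits_iff.1 h.ans i q)
  · rw [read_state, Params.lQ, ofBits_toBits_clog]
    exact Fin.ofNat_eq_cast _ _ |>.trans (Fin.cast_val_eq_self _)
  · exact funext₂ fun i q => Mem.read_eq_bits_iff.1 (Mem.read_eq_answerBits_iff.1 h_out i q)

lemma execProg_map_view (h : Loaded x z s m) :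
    (execProg O (P.hashes ++ BitExpr.compileAll P.outExpr P.adrOut) m).map (P.simulator.view x) =
      PMF.pure (simView O x z s) := by
  obtain ⟨m₁, exec_hashes, h_lt, h_hash⟩ := writes_hashes (O := O) h
  have h₁ : Loaded x z s m₁ := h.congr h_lt
  have below_outExpr (k : Fin (P.n * (P.nQ * P.lE))) : (P.outExpr k).Below P.adrOut :=
    below_cellExpr _ _ _
  obtain ⟨m₂, exec_out, h_lt', h_out⟩ :=
    BitExpr.writes_compileAll (O := O) (m := m₁) below_outExpr
  have h₂ : Loaded x z s m₂ := h₁.congr fun a ha => h_lt' a (ha.trans_le (Nat.le_add_right _ _))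
  have h_view : P.simulator.view x m₂ = simView O x z s :=
    view_of_loaded h₂ (h_out.trans (funext fun k => eval_cellExpr h₁ h_hash _ _ _))
  rw [execProg_append, exec_hashes, PMF.pure_bind, exec_out, PMF.pure_map, h_view]

lemma expect_run_simulator (O : Oracles P) (x : Input P) (z : ZMod 2) (F : ClientView P → ℝ≥0∞) :
    expect (P.simulator.run O x z) F =
      avg fun k => avg fun p => avg fun R => avg fun U => avg fun a =>
        F (simView O x z ⟨k, p, R, U, a⟩) := by
  have expect_execProg_load (s : SimCoins P) :
      expect (execProg O (P.hashes ++ BitExpr.compileAll P.outExpr P.adrOut) (s.load x z))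
        (fun m => F (P.simulator.view x m)) = F (simView O x z s) := by
    rw [← expect_map, execProg_map_view (s.loaded_load x z), expect_pure]
  have expect_sampleStates (m : Mem) (G : Mem → ℝ≥0∞) :
      expect (execProg O P.sampleStates m) G =
        avg fun p : Fin P.n → Fin P.nQ =>
          G (m.write P.adrState (flatten fun i => toBits P.lQ (p i))) :=
    expect_execProg_uniform_loop O G m
  rw [Simulator.run, expect_map]
  simp only [Params.simulator, execProg, execProg_append O P.sampleStates, expect_bind,
    expect_exec_uniform_two_pow, expect_sampleStates,
    ← avg_bijective (flatten_bijective (ZMod 2) P.n P.κ),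
    ← avg_bijective (flatten_bijective (ZMod 2) P.n P.nS),
    ← avg_bijective (answerBits_bijective (P := P))]
  congr! 10 with k p R U a
  exact expect_execProg_load ⟨k, p, R, U, a⟩

end Simulator

/-! ### Hidden keys -/

section HiddenKeys

variable {P : Params}

/-- Indices of the keys of the server: `some (i, q)` stands for the key of the state `q` at
position `i`, and `none` for the key that is shared with the helper. -/
abbrev KeyIndex (P : Params) : Type := Option (Fin P.n × Fin P.nQ)

/-- The coins of the server, with all its keys collected in one family. -/
def ServerCoins.ofKeys (rot : Fin P.n → Fin P.nQ) (r : ZMod 2) (K : KeyIndex P → Key P) :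
    ServerCoins P :=
  ⟨fun i q => K (some (i, q)), rot, r, K none⟩

lemma expect_sampleServerCoins (F : ServerCoins P → ℝ≥0∞) : expect (sampleServerCoins P) F =
    avg fun rot => avg fun r => avg fun K => F (.ofKeys rot r K) := by
  have avg_keys (G : (Fin P.n → Fin P.nQ → Key P) → Key P → ℝ≥0∞) :
      (avg fun kSH => avg fun k => G k kSH) =
        avg fun K : KeyIndex P → Key P => G (fun i q => K (some (i, q))) (K none) := by
    rw [← avg_prod fun kk : Key P × (Fin P.n → Fin P.nQ → Key P) => G kk.2 kk.1,
      ← avg_bijective ((Equiv.piOptionEquivProd (β := fun _ => Key P)).trans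
        ((Equiv.refl _).prodCongr (Equiv.curry _ _ _))).bijective]
    rfl
  simp only [sampleServerCoins, pmf_bind_eq_bind, pmf_pure_eq_pure, expect_bind, expect_pure,
    expect_comm (PMF.uniformOfFintype (Fin P.n → Fin P.nQ → Key P)), avg_keys]
  rfl

/-- The bound on the advantage of an adversary that makes `T` queries: it must guess one of the
keys, unless two of them coincide. -/
noncomputable def advantageBound (P : Params) (T : ℕ) : ℝ≥0∞ :=
  (Fintype.card (KeyIndex P) * (T + Fintype.card (KeyIndex P)) : ℕ) / 2 ^ P.κ

lemma avg_le_avg_add_advantageBound {ι : Type} [Fintype ι] {j : ι → KeyIndex P}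
    (hj : j.Injective) {X Y : (KeyIndex P → Key P) → ℝ≥0∞}
    {Λ : (KeyIndex P → Key P) → Key P → ℝ≥0∞} {T : ℕ} (hX : ∀ K, X K ≤ 1)
    (hXY : ∀ K, K.Injective → X K ≤ Y K + ∑ o, Λ K (K (j o)))
    (hΛ : ∀ o K v, Λ (Function.update K (j o) v) = Λ K) (hT : ∀ K, ∑ v, Λ K v ≤ T) :
    avg X ≤ avg Y + advantageBound P T := by
  set N := Fintype.card (KeyIndex P) with hN
  have card_key : (Fintype.card (Key P) : ℝ≥0∞) = 2 ^ P.κ := by simp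
  have le_add_collision (K : KeyIndex P → Key P) :
      X K ≤ Y K + (∑ o, Λ K (K (j o)) + collision K) := by
    by_cases hK : K.Injective
    · simpa [collision, hK] using hXY K hK
    · simpa [collision, hK, ← add_assoc] using le_add_left (hX K)
  have guess_le : (avg fun K => ∑ o, Λ K (K (j o))) ≤ N * (T / 2 ^ P.κ) := by
    rw [avg, expect_finset_sum]
    refine (Finset.sum_le_card_nsmul _ _ _ fun o _ => avg_apply_le (j o) (hΛ o) hT).trans ?_
    rw [nsmul_eq_mul, card_key]
    gcongr
    exact Fintype.card_le_of_injective j hj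
  have collision_le : (avg fun K : KeyIndex P → Key P => collision K) ≤ N ^ 2 / 2 ^ P.κ :=
    card_key ▸ avg_collision_le
  calc avg X ≤ avg Y + ((avg fun K => ∑ o, Λ K (K (j o))) + avg fun K => collision K) := by
        simpa only [expect_add] using expect_mono (PMF.uniformOfFintype _) le_add_collision
    _ ≤ avg Y + (N * (T / 2 ^ P.κ) + N ^ 2 / 2 ^ P.κ) := by gcongr
    _ = avg Y + advantageBound P T := by
        rw [advantageBound, ← hN, ← mul_div_assoc, ← ENNReal.add_div]
        push_cast
        rw [mul_add, sq]

end HiddenKeys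

/-! ### Security against a semi-honest client -/

section Client

variable {P : Params}

/-- The indices of the keys that the client does not get when its rotated states are `p`. -/
abbrev HiddenIndex (p : Fin P.n → Fin P.nQ) : Type :=
  {o : KeyIndex P // ∀ u ∈ o, u.2 ≠ p u.1}

/-- The keys that the client gets when its rotated states are `p`. -/
def pathKeys (p : Fin P.n → Fin P.nQ) (K : KeyIndex P → Key P) (i : Fin P.n) : Key P :=
  K (some (i, p i))

/-- The queries by which the rows off the path `p` of the client are encrypted. -/
def rowQuery (x : Input P) (p : Fin P.n → Fin P.nQ) (K : KeyIndex P → Key P)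
    (u : {u : Fin P.n × Fin P.nQ // u.2 ≠ p u.1}) : Key P × Bits P.lS :=
  (K (some u), toBits P.lS (x u.1.1))

/-- The queries by which the answers of the server and the helper are masked. -/
def maskQuery (K : KeyIndex P → Key P) (i : Fin P.n) : Key P × Bits P.ln := (K none, toBits P.ln i)

/-- The oracles, reprogrammed at the queries that hide the rows off the path of the client and the
answer of the server: the new values are `ω.1` and `ω.2`. -/
noncomputable def hiddenOracles (x : Input P) (p : Fin P.n → Fin P.nQ) (K : KeyIndex P → Key P)
    (ω : Answer P × Answer P) (O : Oracles P) : Oracles P :=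
  (Function.extend (rowQuery x p K) (fun u => ω.1 u.1.1 u.1.2) O.1,
    Function.extend (maskQuery K) ω.2 O.2)

variable {K : KeyIndex P → Key P}

lemma rowQuery_injective (hK : K.Injective) (x : Input P) (p : Fin P.n → Fin P.nQ) :
    (rowQuery x p K).Injective :=
  fun _ _ h => Subtype.ext (Option.some_injective _ (hK (congrArg Prod.fst h)))

lemma maskQuery_injective (K : KeyIndex P → Key P) : (maskQuery K).Injective :=
  fun _ _ h => toBits_clog_injective P.n (congrArg Prod.snd h)

lemma avg_hiddenOracles (hK : K.Injective) (x : Input P) (p : Fin P.n → Fin P.nQ)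
    (F : Oracles P → ℝ≥0∞) : (avg fun O => avg fun ω => F (hiddenOracles x p K ω O)) = avg F := by
  have avg_rows (G : ({u : Fin P.n × Fin P.nQ // u.2 ≠ p u.1} → Entry P) → ℝ≥0∞) :
      (avg fun R : Answer P => G fun u => R u.1.1 u.1.2) = avg G := by
    rw [← avg_comp_injective Subtype.val_injective,
      ← avg_bijective (Equiv.curry (Fin P.n) (Fin P.nQ) (Entry P)).symm.bijective]
    rfl
  have avg_masks (W g) : (avg fun g' => avg fun U =>
      F (Function.extend (rowQuery x p K) W g, Function.extend (maskQuery K) U g')) =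
        avg fun g' => F (Function.extend (rowQuery x p K) W g, g') :=
    avg_extend (maskQuery_injective K) fun g' => F (Function.extend (rowQuery x p K) W g, g')
  calc (avg fun O => avg fun ω => F (hiddenOracles x p K ω O))
      = avg fun g => avg fun R : Answer P => avg fun g' => avg fun U =>
          F (Function.extend (rowQuery x p K) (fun u => R u.1.1 u.1.2) g,
            Function.extend (maskQuery K) U g') := by
        simp only [avg_prod]
        exact congrArg avg (funext fun g => expect_comm _ _ _)
    _ = avg fun g => avg fun W => avg fun g' => F (Function.extend (rowQuery x p K) W g, g') := by
        simp only [avg_masks]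
        exact congrArg avg (funext fun g => avg_rows fun W => avg fun g' =>
          F (Function.extend (rowQuery x p K) W g, g'))
    _ = avg F := by
        rw [avg_extend (rowQuery_injective hK x p) fun g => avg fun g' => F (g, g'), avg_prod]

lemma hiddenOracles_congr {x : Input P} {p : Fin P.n → Fin P.nQ} {k : Key P}
    (hk : ∀ o : HiddenIndex p, K o ≠ k) (ω : Answer P × Answer P) (O : Oracles P) :
    (hiddenOracles x p K ω O).H k = O.H k ∧ (hiddenOracles x p K ω O).mask k = O.mask k :=
  ⟨funext fun s => Function.extend_apply' (f := rowQuery x p K)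
      (fun u => ω.1 u.1.1 u.1.2) O.1 (k, s) fun ⟨u, hu⟩ =>
        hk ⟨some u, fun _ hv => Option.mem_some.1 hv ▸ u.2⟩ (congrArg Prod.fst hu),
    funext fun s => Function.extend_apply' (f := maskQuery K) ω.2 O.2 (k, s)
      fun ⟨_, hi⟩ => hk ⟨none, by simp⟩ (congrArg Prod.fst hi)⟩

lemma clientView_hiddenOracles (hK : K.Injective) (M : FSM P) (x : Input P)
    (rot : Fin P.n → Fin P.nQ) (r : ZMod 2) (a : Shares P) (ω : Answer P × Answer P)
    (O : Oracles P) :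
    let p := position M x rot
    let c := ServerCoins.ofKeys rot r K
    clientView (hiddenOracles x p K ω O) M x c a = simView O x (r + result M x)
      ⟨pathKeys p K, p, (fun i q => payload M c i (x i) q) + ω.1,
        partialAnswer 0 (setupMsg (hiddenOracles x p K (ω.1, 0) O) M c) a + ω.2, a⟩ := by
  intro p c
  set O' := hiddenOracles x p K ω O
  have ansS_eq : partialAnswer O' (setupMsg O' M c) a =
      partialAnswer 0 (setupMsg (hiddenOracles x p K (ω.1, 0) O) M c) a + ω.2 := by
    funext i
    have mask_eq : O'.mask c.kSH (toBits P.ln i) = ω.2 i :=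
      (maskQuery_injective K).extend_apply ω.2 O.2 i
    exact congrArg₂ _ (add_zero _).symm mask_eq
  have column_eq (i : Fin P.n) : garble O' M c i (x i) = simColumns O x (r + result M x)
      ⟨pathKeys p K, p, (fun i q => payload M c i (x i) q) + ω.1, ω.2, a⟩ i := by
    funext q
    rw [garble, simColumns]
    dsimp only
    split_ifs with hq
    · have hash_eq : O'.H (c.k i q) (toBits P.lS (x i)) = O.H (c.k i q) (toBits P.lS (x i)) :=
        Function.extend_apply' (f := rowQuery x p K) (fun u => ω.1 u.1.1 u.1.2) O.1
          (c.k i q, toBits P.lS (x i)) fun ⟨u, hu⟩ => by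
            have hu' : u.1 = (i, q) := Option.some_injective _ (hK (congrArg Prod.fst hu))
            exact u.2 (by rw [hu']; exact hq)
      rw [hash_eq, hq]
      exact congrArg _ (payload_position M x c i)
    · have hash_eq : O'.H (c.k i q) (toBits P.lS (x i)) = ω.1 i q :=
        (rowQuery_injective hK x p).extend_apply (fun u => ω.1 u.1.1 u.1.2) O.1 ⟨(i, q), hq⟩
      rw [hash_eq, add_comm]
      rfl
  have start_eq : startMsg M c = (p 0, pathKeys p K 0) := by
    simp [startMsg, p, c, position, trace, pathKeys, ServerCoins.ofKeys]
  rw [clientView, partialAnswer_helperShares, ansS_eq, start_eq]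
  exact congrArg (ClientView.mk x a _ _) (congrArg _ (funext column_eq))

/-- The reprogrammed values are one-time pads for the rows and the answer. -/
lemma avg_clientView_hiddenOracles (hK : K.Injective) (M : FSM P) (x : Input P)
    (rot : Fin P.n → Fin P.nQ) (r : ZMod 2) (a : Shares P) (O : Oracles P)
    (F : ClientView P → ℝ≥0∞) :
    (avg fun ω => F (clientView (hiddenOracles x (position M x rot) K ω O) M x
      (.ofKeys rot r K) a)) =
    avg fun R => avg fun U => F (simView O x (r + result M x)
      ⟨pathKeys (position M x rot) K, position M x rot, R, U, a⟩) := by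
  let G (R U : Answer P) : ℝ≥0∞ := F (simView O x (r + result M x)
    ⟨pathKeys (position M x rot) K, position M x rot, R, U, a⟩)
  simp only [clientView_hiddenOracles hK, avg_prod]
  exact (congrArg avg (funext fun W => avg_add_left _ (G (_ + W)))).trans
    (avg_add_left _ fun R => avg (G R))

lemma realClient_apply (M : FSM P) (x : Input P) (D : Distinguisher P) (y : Bool) :
    realClient M x D y = avg fun rot => avg fun r => avg fun K => avg fun a => avg fun O =>
      (D (clientView O M x (.ofKeys rot r K) a) r).run O y := by
  simp only [realClient, pmf_bind_eq_bind, bind_apply_eq_expect,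
    expect_comm (PMF.uniformOfFintype (Oracles P)), expect_sampleServerCoins]
  rfl

lemma idealClient_apply (M : FSM P) (x : Input P) (D : Distinguisher P) (y : Bool) :
    idealClient P.simulator M x D y = avg fun rot => avg fun r => avg fun K =>
      avg fun a => avg fun O => avg fun R => avg fun U => (D (simView O x (r + result M x)
        ⟨pathKeys (position M x rot) K, position M x rot, R, U, a⟩) r).run O y := by
  have position_bijective : (position M x).Bijective :=
    AddGroup.addLeft_bijective fun i : Fin P.n => trace M x i
  have avg_pathKeys (p : Fin P.n → Fin P.nQ) (G : (Fin P.n → Key P) → ℝ≥0∞) :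
      (avg fun K => G (pathKeys p K)) = avg G :=
    avg_comp_injective (f := fun i => some (i, p i))
      (fun _ _ h => congrArg Prod.fst (Option.some_injective _ h)) G
  simp only [idealClient, pmf_bind_eq_bind, bind_apply_eq_expect, expect_run_simulator]
  have avg_path (G : (Fin P.n → Key P) → (Fin P.n → Fin P.nQ) → ℝ≥0∞) :
      (avg fun k => avg fun p => G k p) = avg fun rot => avg fun K =>
        G (pathKeys (position M x rot) K) (position M x rot) := by
    refine (expect_comm _ _ G).trans ((avg_bijective position_bijective _).symm.trans ?_)
    exact congrArg avg (funext fun rot => (avg_pathKeys _ fun k => G k (position M x rot)).symm)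
  simp only [avg_path, expect_comm (PMF.uniformOfFintype (Shares P)),
    expect_comm _ (PMF.uniformOfFintype (Oracles P)),
    expect_comm (PMF.uniformOfFintype (Fin P.n → Fin P.nQ)) (PMF.uniformOfFintype (ZMod 2))]

lemma realClient_le (M : FSM P) (x : Input P) {D : Distinguisher P} {T : ℕ}
    (hD : ∀ v r, (D v r).QueryBound T) (y : Bool) :
    realClient M x D y ≤ idealClient P.simulator M x D y + advantageBound P T := by
  let avgIdeal (rot : Fin P.n → Fin P.nQ) (r : ZMod 2) (k : Fin P.n → Key P)
      (F : Oracles P → ClientView P → ℝ≥0∞) : ℝ≥0∞ :=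
    avg fun a => avg fun O => avg fun R => avg fun U =>
      F O (simView O x (r + result M x) ⟨k, position M x rot, R, U, a⟩)
  have le_add (rot : Fin P.n → Fin P.nQ) (r : ZMod 2) :
      (avg fun K => avg fun a => avg fun O =>
        (D (clientView O M x (.ofKeys rot r K) a) r).run O y) ≤
      (avg fun K => avgIdeal rot r (pathKeys (position M x rot) K) fun O v => (D v r).run O y) +
        advantageBound P T := by
    refine avg_le_avg_add_advantageBound (j := fun o : HiddenIndex (position M x rot) => o.1)
      (Λ := fun K k => avgIdeal rot r (pathKeys (position M x rot) K) fun O v =>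
        (D v r).queries O k) Subtype.val_injective
      (fun K => expect_le_of_le _ fun a => expect_le_of_le _ fun O => PMF.coe_le_one _ _)
      (fun K hK => ?_) (fun o K v => ?_) fun K => ?_
    · simp only [avgIdeal, ← expect_finset_sum, ← expect_add]
      refine expect_mono _ fun a => (OracleComp.avg_run_le
        (fun o : HiddenIndex (position M x rot) => K o) (avg_hiddenOracles hK x _)
        (fun ω O k hk => hiddenOracles_congr hk ω O)
        (fun O => D (clientView O M x (.ofKeys rot r K) a) r) y).trans ?_
      exact expect_mono _ fun O => (avg_clientView_hiddenOracles hK M x rot r a O fun v =>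
        (D v r).run O y + ∑ o : HiddenIndex (position M x rot), (D v r).queries O (K o)).le
    · have pathKeys_update : pathKeys (position M x rot) (Function.update K o v) =
          pathKeys (position M x rot) K :=
        funext fun i => Function.update_of_ne (fun h => o.2 (i, position M x rot i) h.symm rfl) _ _
      rw [pathKeys_update]
    · simp only [avgIdeal, ← expect_finset_sum]
      exact expect_le_of_le _ fun a => expect_le_of_le _ fun O => expect_le_of_le _ fun R =>
        expect_le_of_le _ fun U => OracleComp.sum_queries_le O (hD _ r)
  calc realClient M x D y
      ≤ avg fun rot => avg fun r =>
          (avg fun K => avgIdeal rot r (pathKeys (position M x rot) K) fun O v =>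
            (D v r).run O y) + advantageBound P T := by
        rw [realClient_apply]
        exact expect_mono _ fun rot => expect_mono _ fun r => le_add rot r
    _ = idealClient P.simulator M x D y + advantageBound P T := by
        simp only [idealClient_apply, expect_add, expect_const, avgIdeal]

end Client

/-! ### Privacy against a malicious helper -/

section Helper

variable {P : Params}

/-- The queries by which the server encrypts the matrices. -/
def garbleQuery (K : KeyIndex P → Key P) (u : Fin P.n × Fin P.nS × Fin P.nQ) :
    Key P × Bits P.lS :=
  (K (some (u.1, u.2.2)), toBits P.lS u.2.1)

/-- The oracles, reprogrammed at the queries that encrypt the matrices: the new values are `W`. -/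
noncomputable def paddedOracles (K : KeyIndex P → Key P) (W : Garbled P) (O : Oracles P) :
    Oracles P :=
  (Function.extend (garbleQuery K) (fun u => W u.1 u.2.1 u.2.2) O.1, O.2)

variable {K : KeyIndex P → Key P}

lemma garbleQuery_injective (hK : K.Injective) : (garbleQuery K).Injective := by
  rintro ⟨i, s, q⟩ ⟨i', s', q'⟩ h
  have hiq : (i, q) = (i', q') := Option.some_injective _ (hK (congrArg Prod.fst h))
  have hs : s = s' := toBits_clog_injective P.nS (congrArg Prod.snd h)
  simp_all

lemma avg_paddedOracles (hK : K.Injective) (F : Oracles P → ℝ≥0∞) :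
    (avg fun O => avg fun W => F (paddedOracles K W O)) = avg F := by
  have uncurry_bijective :
      (fun (W : Garbled P) (u : Fin P.n × Fin P.nS × Fin P.nQ) => W u.1 u.2.1 u.2.2).Bijective :=
    ((Equiv.curry _ _ _).trans (Equiv.piCongrRight fun _ => Equiv.curry _ _ _)).symm.bijective
  have avg_values (g) : (avg fun g' => avg fun W => F (paddedOracles K W (g, g'))) =
      avg fun w => avg fun g' => F (Function.extend (garbleQuery K) w g, g') :=
    (expect_comm _ _ _).trans (avg_bijective uncurry_bijective fun w => avg fun g' =>
      F (Function.extend (garbleQuery K) w g, g'))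
  simp only [avg_prod, avg_values,
    avg_extend (garbleQuery_injective hK) fun g => avg fun g' => F (g, g')]

lemma paddedOracles_congr {k : Key P} (hk : ∀ u, K (some u) ≠ k) (W : Garbled P)
    (O : Oracles P) :
    (paddedOracles K W O).H k = O.H k ∧ (paddedOracles K W O).mask k = O.mask k :=
  ⟨funext fun s => Function.extend_apply' (f := garbleQuery K) (fun u => W u.1 u.2.1 u.2.2) O.1
    (k, s) fun ⟨u, hu⟩ => hk (u.1, u.2.2) (congrArg Prod.fst hu), rfl⟩

lemma setupMsg_paddedOracles (hK : K.Injective) (M : FSM P) (rot : Fin P.n → Fin P.nQ)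
    (r : ZMod 2) (W : Garbled P) (O : Oracles P) :
    setupMsg (paddedOracles K W O) M (.ofKeys rot r K) =
      (fun i s q => payload M (.ofKeys rot r K) i s q + W i s q, K none) := by
  refine Prod.ext (funext fun i => funext fun s => funext fun q => ?_) rfl
  have hash_eq : (paddedOracles K W O).H (K (some (i, q))) (toBits P.lS s) = W i s q :=
    (garbleQuery_injective hK).extend_apply (fun u => W u.1 u.2.1 u.2.2) O.1 (i, s, q)
  exact (congrArg (· + _) hash_eq).trans (add_comm _ _)

namespace MaliciousHelper

variable (A : MaliciousHelper P)

/-- The inputs that the honest parties use in the game when the bit is `b`. -/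
def challenge (ch : (FSM P × Input P) × (FSM P × Input P) × A.State) (b : Bool) :
    FSM P × Input P :=
  if b then ch.2.1 else ch.1

/-- The game as a computation of the helper, in which the message of the server is given as a
function `m` of its machine, so that it need not be computed with the oracles of the helper. -/
def attack (m : FSM P → SetupMsg P) (a : Shares P) (b : Bool) : OracleComp P Bool :=
  A.choose.bind fun ch => (A.respond ch.2.2 (m (A.challenge ch b).1)
    (helperShares (A.challenge ch b).2 a)).bind fun out => .done (out.2 == b)

variable {A} (m : FSM P → SetupMsg P) (a : Shares P) (b : Bool) (O : Oracles P)

lemma run_attack (y : Bool) : (A.attack m a b).run O y =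
    expect (A.choose.run O) fun ch => expect ((A.respond ch.2.2 (m (A.challenge ch b).1)
      (helperShares (A.challenge ch b).2 a)).run O) fun out => PMF.pure (out.2 == b) y := by
  simp only [attack, OracleComp.run_bind, bind_apply_eq_expect, OracleComp.run]

lemma queries_attack (k : Key P) : (A.attack m a b).queries O k =
    A.choose.queries O k + expect (A.choose.run O) fun ch =>
      (A.respond ch.2.2 (m (A.challenge ch b).1)
        (helperShares (A.challenge ch b).2 a)).queries O k := by
  simp only [attack, OracleComp.queries_bind, OracleComp.queries, expect_const, add_zero]

lemma sum_queries_attack_le {T : ℕ} (hA : A.QueryBound T) :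
    ∑ k, (A.attack m a b).queries O k ≤ (2 * T : ℕ) := by
  simp only [queries_attack, Finset.sum_add_distrib, ← expect_finset_sum]
  rw [two_mul, Nat.cast_add]
  exact add_le_add (OracleComp.sum_queries_le O hA.1) (expect_le_of_le _ fun ch =>
    OracleComp.sum_queries_le O (hA.2 _ _ _))

lemma game_apply (y : Bool) : A.game y = avg fun rot => avg fun r => avg fun K => avg fun a =>
    avg fun b => avg fun O =>
      (A.attack (fun M => setupMsg O M (.ofKeys rot r K)) a b).run O y := by
  simp only [game, exec, pmf_bind_eq_bind, pmf_pure_eq_pure, PMF.bind_bind, PMF.pure_bind,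
    bind_apply_eq_expect, expect_sampleServerCoins, run_attack,
    expect_comm (PMF.uniformOfFintype Bool), expect_comm _ (PMF.uniformOfFintype (Oracles P)),
    expect_comm _ (A.choose.run _)]
  rfl

/-- Uniformly random garbled matrices remain so when plaintexts are added that depend on the
choices of the helper, since these are made before the matrices are sent. -/
lemma avg_run_attack_add (g : FSM P → Garbled P) (k : Key P) (y : Bool) :
    (avg fun W : Garbled P =>
        (A.attack (fun M => (fun i s q => g M i s q + W i s q, k)) a b).run O y) =
      avg fun W => (A.attack (fun _ => (W, k)) a b).run O y := by
  simp only [run_attack, expect_comm (PMF.uniformOfFintype (Garbled P)) (A.choose.run O)]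
  exact congrArg _ (funext fun ch => avg_add_left (g _) fun W =>
    expect ((A.respond ch.2.2 (W, k) (helperShares (A.challenge ch b).2 a)).run O) fun out =>
      PMF.pure (out.2 == b) y)

lemma avg_queries_attack_add (g : FSM P → Garbled P) (k k' : Key P) :
    (avg fun W : Garbled P =>
        (A.attack (fun M => (fun i s q => g M i s q + W i s q, k)) a b).queries O k') =
      avg fun W => (A.attack (fun _ => (W, k)) a b).queries O k' := by
  simp only [queries_attack, expect_add,
    expect_comm (PMF.uniformOfFintype (Garbled P)) (A.choose.run O)]
  exact congrArg _ (congrArg _ (funext fun ch => avg_add_left (g _) fun W =>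
    (A.respond ch.2.2 (W, k) (helperShares (A.challenge ch b).2 a)).queries O k'))

lemma avg_run_attack_eq (k : Key P) (y : Bool) :
    (avg fun a => avg fun b => avg fun O => avg fun W =>
      (A.attack (fun _ => (W, k)) a b).run O y) = PMF.uniformOfFintype Bool y := by
  let p : PMF Bool := (PMF.uniformOfFintype (Oracles P)).bind fun O =>
    (PMF.uniformOfFintype (Garbled P)).bind fun W => (A.choose.run O).bind fun ch =>
      (PMF.uniformOfFintype (Shares P)).bind fun a =>
        ((A.respond ch.2.2 (W, k) a).run O).map Prod.snd
  rw [← uniform_bind_beq p, bind_apply_eq_expect]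
  refine (expect_comm _ _ _).trans (congrArg _ (funext fun b => ?_))
  simp only [p, bind_apply_eq_expect, expect_bind, expect_map, run_attack,
    expect_comm (PMF.uniformOfFintype (Shares P))]
  congr! 6 with O W ch
  exact avg_add_left (oneHot (A.challenge ch b).2) fun a =>
    expect ((A.respond ch.2.2 (W, k) a).run O) fun out => PMF.pure (out.2 == b) y

lemma game_le {T : ℕ} (hA : A.QueryBound T) (y : Bool) :
    A.game y ≤ PMF.uniformOfFintype Bool y + advantageBound P (2 * T) := by
  rw [game_apply]
  refine expect_le_of_le _ fun rot => expect_le_of_le _ fun r => ?_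
  rw [← expect_const (PMF.uniformOfFintype (KeyIndex P → Key P)) (PMF.uniformOfFintype Bool y)]
  refine avg_le_avg_add_advantageBound
    (Λ := fun K k => avg fun a => avg fun b => avg fun O => avg fun W =>
      (A.attack (fun _ => (W, K none)) a b).queries O k) (Option.some_injective _)
    (fun K => ?_) (fun K hK => ?_) (fun u K v => ?_) fun K => ?_
  · exact expect_le_of_le _ fun a => expect_le_of_le _ fun b => expect_le_of_le _ fun O =>
      PMF.coe_le_one _ _
  · rw [← avg_run_attack_eq (A := A) (K none)]
    simp only [← expect_finset_sum, ← expect_add]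
    refine expect_mono _ fun a => expect_mono _ fun b => (OracleComp.avg_run_le
      (fun u => K (some u)) (avg_paddedOracles hK) (fun W O k hk => paddedOracles_congr hk W O)
      (fun O => A.attack (fun M => setupMsg O M (.ofKeys rot r K)) a b) y).trans_eq ?_
    simp only [setupMsg_paddedOracles hK, expect_add, expect_finset_sum, avg_run_attack_add,
      avg_queries_attack_add]
  · simp only [Function.update_of_ne (Option.some_ne_none u).symm]
  · simp only [← expect_finset_sum]
    exact expect_le_of_le _ fun a => expect_le_of_le _ fun b => expect_le_of_le _ fun O =>
      expect_le_of_le _ fun W => sum_queries_attack_le _ a b O hA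

end MaliciousHelper

end Helper

/-! ### Negligible functions -/

section Negligible

lemma polyBounded_const (c : ℕ) : PolyBounded fun _ => c :=
  ⟨c, fun l => c.lt_two_pow_self.le.trans (Nat.pow_le_pow_left (Nat.le_add_left 2 l) c)⟩

namespace PolyBounded

variable {f g : ℕ → ℕ}

lemma of_le (hg : PolyBounded g) (h : ∀ l, f l ≤ g l) : PolyBounded f :=
  hg.imp fun _ hc l => (h l).trans (hc l)

lemma mul (hf : PolyBounded f) (hg : PolyBounded g) : PolyBounded fun l => f l * g l := by
  obtain ⟨c, hc⟩ := hf
  obtain ⟨d, hd⟩ := hg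
  exact ⟨c + d, fun l => pow_add (l + 2) c d ▸ Nat.mul_le_mul (hc l) (hd l)⟩

lemma add (hf : PolyBounded f) (hg : PolyBounded g) : PolyBounded fun l => f l + g l := by
  obtain ⟨c, hc⟩ := hf
  obtain ⟨d, hd⟩ := hg
  have pow_le {e : ℕ} (he : e ≤ c + d) (l : ℕ) : (l + 2) ^ e ≤ (l + 2) ^ (c + d) :=
    Nat.pow_le_pow_right (by omega) he
  refine ⟨c + d + 1, fun l => ?_⟩
  calc f l + g l
      ≤ (l + 2) ^ (c + d) + (l + 2) ^ (c + d) :=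
        add_le_add ((hc l).trans (pow_le (by omega) l)) ((hd l).trans (pow_le (by omega) l))
    _ = (l + 2) ^ (c + d) * 2 := (mul_two _).symm
    _ ≤ (l + 2) ^ (c + d + 1) := Nat.mul_le_mul_left _ (Nat.le_add_left 2 l)

lemma negligible_div_two_pow {κ : ℕ → ℕ} (hf : PolyBounded f) (hκ : ∀ l, l ≤ κ l) :
    Negligible fun l => (f l : ℝ) / 2 ^ κ l := by
  obtain ⟨c, hc⟩ := hf
  have negligible_half_pow : Negligible fun l => (1 / 2 : ℝ) ^ l := fun k =>
    tendsto_pow_const_mul_const_pow_of_abs_lt_one k (by norm_num [abs_of_pos])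
  refine (negligible_half_pow.polynomial_mul ((Polynomial.X + 2) ^ c)).trans_abs_le fun l => ?_
  have hfc : (f l : ℝ) ≤ (l + 2) ^ c := by exact_mod_cast hc l
  have h_pow : (2 : ℝ) ^ l ≤ 2 ^ κ l := pow_le_pow_right₀ one_le_two (hκ l)
  have h_eval : ((Polynomial.X + 2 : Polynomial ℝ) ^ c).eval (l : ℝ) = (l + 2) ^ c := by simp
  rw [h_eval, one_div, inv_pow, ← div_eq_mul_inv, abs_of_nonneg (by positivity),
    abs_of_nonneg (by positivity)]
  gcongr

end PolyBounded

lemma advantageBound_ne_top (P : Params) (T : ℕ) : advantageBound P T ≠ ∞ :=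
  ENNReal.div_ne_top (ENNReal.natCast_ne_top _) (by simp)

lemma negligible_of_le_advantageBound {P : ℕ → Params} (hP : Admissible P) {T : ℕ → ℕ}
    (hT : PolyBounded T) {f : ℕ → ℝ} (hf : ∀ l, |f l| ≤ (advantageBound (P l) (T l)).toReal) :
    Negligible fun l => |f l| := by
  have polyBounded_card : PolyBounded fun l => Fintype.card (KeyIndex (P l)) := by
    refine ((hP.2.mul hP.2).add (polyBounded_const 1)).of_le fun l => ?_
    rw [Fintype.card_option, Fintype.card_prod, Fintype.card_fin, Fintype.card_fin]
    gcongr <;> · rw [Params.size]; omega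
  refine ((polyBounded_card.mul (hT.add polyBounded_card)).negligible_div_two_pow
    hP.1).trans_abs_le fun l => ?_
  rw [abs_abs]
  refine (hf l).trans_eq ?_
  rw [advantageBound, ENNReal.toReal_div, ENNReal.toReal_natCast, ENNReal.toReal_pow,
    ENNReal.toReal_ofNat, abs_of_nonneg (by positivity)]

end Negligible

end HelperProtocol

theorem mainTheorem2_general (P : Params) :
    (∀ (O : Oracles P) (M : FSM P) (x : Input P) (c : ServerCoins P) (a : Shares P),
      (∀ i, (clientView O M x c a).columns i = garble O M c i (x i)) ∧
      clientOutput O (clientView O M x c a) = c.r + result M x) ∧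
    P.simulator.cost ≤ (P.size + 2) ^ 5 ∧
    (∀ (M : FSM P) (x : Input P) (D : Distinguisher P) (T : ℕ),
      (∀ v r, (D v r).QueryBound T) →
      |prob (realClient M x D) - prob (idealClient P.simulator M x D)| ≤
        (advantageBound P T).toReal) ∧
    (∀ A : MaliciousServer P, prob A.game = 1 / 2) ∧
    (∀ (A : MaliciousHelper P) (T : ℕ), A.QueryBound T →
      |prob A.game - 1 / 2| ≤ (advantageBound P (2 * T)).toReal) :=
  ⟨fun O M x c a => ⟨clientView_columns O M x c a, clientOutput_clientView O M x c a⟩,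
    P.cost_simulator_le,
    fun M x _ T hD => abs_prob_sub_le (advantageBound_ne_top P T) (realClient_le M x hD),
    fun A => A.game_eq_uniform ▸ prob_uniform,
    fun _ T hA => prob_uniform ▸
      abs_prob_sub_le (advantageBound_ne_top P (2 * T)) (MaliciousHelper.game_le hA)⟩

/-- Correctness and security of the three-party protocol, in the random oracle model. -/
theorem mainTheorem2 :
    -- Recombination and correctness, for all inputs, oracles and coins.
    (∀ (P : Params) (O : Oracles P) (M : FSM P) (x : Input P) (c : ServerCoins P) (a : Shares P),
      (∀ i, (clientView O M x c a).columns i = garble O M c i (x i)) ∧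
      clientOutput O (clientView O M x c a) = c.r + result M x) ∧
    -- Simulation security against a semi-honest client, with a polynomial-size simulator.
    (∃ (S : (P : Params) → Simulator P) (d : ℕ),
      (∀ P, (S P).cost ≤ (P.size + 2) ^ d) ∧
      ∀ P : ℕ → Params, Admissible P →
      ∀ (M : (l : ℕ) → FSM (P l)) (x : (l : ℕ) → Input (P l))
        (D : (l : ℕ) → Distinguisher (P l)) (T : ℕ → ℕ), PolyBounded T →
        (∀ l v r, (D l v r).QueryBound (T l)) →
        Negligible fun l =>
          |prob (realClient (M l) (x l) (D l)) - prob (idealClient (S (P l)) (M l) (x l) (D l))|) ∧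
    -- Privacy against a malicious server.
    (∀ P : ℕ → Params, Admissible P →
      ∀ (A : (l : ℕ) → MaliciousServer (P l)) (T : ℕ → ℕ), PolyBounded T →
        (∀ l, (A l).QueryBound (T l)) →
        Negligible fun l => |prob (A l).game - 1 / 2|) ∧
    -- Privacy against a malicious helper.
    (∀ P : ℕ → Params, Admissible P →
      ∀ (A : (l : ℕ) → MaliciousHelper (P l)) (T : ℕ → ℕ), PolyBounded T →
        (∀ l, (A l).QueryBound (T l)) →
        Negligible fun l => |prob (A l).game - 1 / 2|) := by
  choose correct cost client server helper using mainTheorem2_general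
  refine ⟨correct, ⟨Params.simulator, 5, cost, fun P hP M x D T hT hD => ?_⟩,
    fun P _ A _ _ _ => ?_, fun P hP A T hT hA => ?_⟩
  · exact negligible_of_le_advantageBound hP hT fun l =>
      client (P l) (M l) (x l) (D l) (T l) (hD l)
  · simp only [server, sub_self, abs_zero]
    exact Asymptotics.superpolynomialDecay_zero _ _
  · exact negligible_of_le_advantageBound hP ((polyBounded_const 2).mul hT) fun l =>
      helper (P l) (A l) (T l) (hA l)
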